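/- **Theorem 2.6 (Fourth order approximations for the right Riemann–Liouville derivative).** Notation. For $\beta>0$ and $n=\lfloor\beta\rfloor+1$, the right Riemann–Liouville derivative of $u:\mathbb R\to\mathbb C$ is $$ {}_xD_\infty^{\beta}u(x)=\frac{(-1)^n}{\Gamma(n-\beta)}\frac{d^n}{dx^n}\int_x^\infty(\xi-x)^{n-\beta-1}u(\xi)\,d\xi ,$$ and it is said to exist on $\mathbb R$ if for every real $x$ the integral converges absolutely and, as a function of $x$, it is $n$ times differentiable on $\mathbb R$. The Fourier transform is $\widehat u(\omega)=\int_{\mathbb R}e^{i\omega x}u(x)\,dx$. For $\alpha\in(1,2)$, $h>0$ and an integer $p$ put $$ {}_RA_p^{\alpha}u(x)=\frac1{h^\alpha}\sum_{k=0}^\infty q_k^\alpha\,u(x+(k-p)h),\qquad q_k^\alpha=\Big(\frac32\Big)^{\alpha}\sum_{m=0}^k3^{-m}g_m^\alpha g_{k-m}^\alpha,\qquad g_k^\alpha=(-1)^k\binom{\alpha}{k}.$$ For integers $p,q,r,s$ with $p\ne q$, $r\ne s$, $rs\neq pq$ put $$ {}_{2R}A_{p,q}^\alpha u=\frac{q}{q-p}\,{}_RA_p^\alpha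 u+\frac{p}{p-q}\,{}_RA_q^\alpha u,$$ $$ {}_{3R}A_{p,q,r,s}^\alpha u=\frac{3rs+2\alpha}{3(rs-pq)}\,{}_{2R}A_{p,q}^\alpha u+\frac{3pq+2\alpha}{3(pq-rs)}\,{}_{2R}A_{r,s}^\alpha u,$$ $$ a_{p,q,r,s}=rs-pq,\qquad b_{p,q,r,s}=6pqrs(r+s-p-q)+4\alpha\big[rs(r+s)-pq(p+q)\big]+9\alpha(rs-pq).$$ Let $\alpha\in(1,2)$, and let $p,q,r,s,\overline p,\overline q,\overline r,\overline s$ be integers with $p\ne q$, $r\ne s$, $\overline p\ne\overline q$, $\overline r\ne\overline s$, $rs\ne pq$, $\overline r\,\overline s\ne\overline p\,\overline q$ and $a\overline b\ne\overline a b$, where $a=a_{p,q,r,s}$, $b=b_{p,q,r,s}$, $\overline a=a_{\overline p,\overline q,\overline r,\overline s}$, $\overline b=b_{\overline p,\overline q,\overline r,\overline s}$. Put $$ {}_{4R}A^\alpha u=\frac{a\overline b}{a\overline b-\overline a b}\,{}_{3R}A_{p,q,r,s}^\alpha u+\frac{\overline a b}{\overline a b-a\overline b}\,{}_{3R}A_{\overline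 p,\overline q,\overline r,\overline s}^\alpha u .$$ Let $u:\mathbb R\to\mathbb C$ be continuous, suppose that ${}_xD_\infty^{\alpha+4}u$ exists on $\mathbb R$, and that $u$, ${}_xD_\infty^{\alpha+4}u$ and their Fourier transforms belong to $L^1(\mathbb R)$. Then ${}_xD_\infty^{\alpha}u$ exists on $\mathbb R$, for every $h>0$, $x\in\mathbb R$ and integer $j$ the series $\sum_{k\ge0}q_k^\alpha u(x+(k-j)h)$ converges absolutely, and $$ {}_xD_\infty^{\alpha}u(x)={}_{4R}A^\alpha u(x)+\mathcal O(h^4)$$ uniformly in $x$: there is a constant $C$, independent of $h$ and $x$, such that $|{}_xD_\infty^{\alpha}u(x)-{}_{4R}A^\alpha u(x)|\le C h^4$ for all $h>0$ and all $x\in\mathbb R$. -/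

import Mathlib

namespace WSLD

noncomputable section

/-- The Fourier transform in the normalisation `û(ω) = ∫ e^{iωx} u(x) dx`. -/
def fourierHat (u : ℝ → ℂ) (ω : ℝ) : ℂ :=
  ∫ x : ℝ, Complex.exp (Complex.I * (ω : ℂ) * (x : ℂ)) * u x

/-- The number `n` of derivatives in the Riemann–Liouville derivative of order `β ≥ 0`:
the integer with `n - 1 ≤ β < n`. -/
def rlOrder (β : ℝ) : ℕ := ⌊β⌋₊ + 1

/-- The function `x ↦ ∫_x^∞ (ξ - x)^{n - β - 1} u(ξ) dξ`, with `n - 1 ≤ β < n`. -/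
def rightRLKernelIntegral (β : ℝ) (u : ℝ → ℂ) (x : ℝ) : ℂ :=
  ∫ ξ in Set.Ioi x, ((ξ - x) ^ ((rlOrder β : ℝ) - β - 1)) • u ξ

/-- The right Riemann–Liouville derivative of order `β`,
`((-1)^n / Γ(n - β)) (d/dx)^n ∫_x^∞ (ξ - x)^{n - β - 1} u(ξ) dξ`, with `n - 1 ≤ β < n`. -/
def rightRL (β : ℝ) (u : ℝ → ℂ) (x : ℝ) : ℂ :=
  ((-1 : ℝ) ^ rlOrder β / Real.Gamma ((rlOrder β : ℝ) - β)) •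
    iteratedDeriv (rlOrder β) (rightRLKernelIntegral β u) x

/-- The right Riemann–Liouville derivative of order `β` of `u` exists at every real point:
the integrals in its definition converge absolutely, and as a function of the lower limit they are
`n` times differentiable. -/
def RightRLExists (β : ℝ) (u : ℝ → ℂ) : Prop :=
  (∀ x : ℝ, MeasureTheory.IntegrableOn
    (fun ξ : ℝ => ((ξ - x) ^ ((rlOrder β : ℝ) - β - 1)) • u ξ) (Set.Ioi x)) ∧
  ∀ k < rlOrder β, Differentiable ℝ (iteratedDeriv k (rightRLKernelIntegral β u))

/-- `g_k = (-1)^k binom(α, k)`, the Taylor coefficients of `(1 - ζ)^α`. -/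
def gCoeff (α : ℝ) (k : ℕ) : ℝ := (-1) ^ k * Ring.choose α k

/-- `q_k = (3/2)^α ∑_{m=0}^k 3^{-m} g_m g_{k-m}`, the Taylor coefficients of
`(3/2 - 2ζ + ζ²/2)^α`. -/
def qCoeff (α : ℝ) (k : ℕ) : ℝ :=
  (3 / 2 : ℝ) ^ α *
    ∑ m ∈ Finset.range (k + 1), ((3 : ℝ) ^ m)⁻¹ * gCoeff α m * gCoeff α (k - m)

/-- The right Lubich operator with shift `p` and step `h`:
`h^{-α} ∑_{k ≥ 0} q_k u(x + (k - p) h)`. -/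
def rightA (α h : ℝ) (p : ℤ) (u : ℝ → ℂ) (x : ℝ) : ℂ :=
  (1 / h ^ α) • ∑' k : ℕ, qCoeff α k • u (x + ((k : ℝ) - (p : ℝ)) * h)

/-- `w_p = q / (q - p)`; the companion weight `w_q = p / (p - q)` is `w₂ q p`. -/
def w₂ (p q : ℤ) : ℝ := (q : ℝ) / ((q : ℝ) - (p : ℝ))

def rightA₂ (α h : ℝ) (p q : ℤ) (u : ℝ → ℂ) (x : ℝ) : ℂ :=
  w₂ p q • rightA α h p u x + w₂ q p • rightA α h q u x

/-- `w_{p,q} = (3rs + 2α) / (3(rs - pq))`; the companion weight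
`w_{r,s} = (3pq + 2α) / (3(pq - rs))` is `w₃ α r s p q`. -/
def w₃ (α : ℝ) (p q r s : ℤ) : ℝ :=
  (3 * (r : ℝ) * s + 2 * α) / (3 * ((r : ℝ) * s - (p : ℝ) * q))

def rightA₃ (α h : ℝ) (p q r s : ℤ) (u : ℝ → ℂ) (x : ℝ) : ℂ :=
  w₃ α p q r s • rightA₂ α h p q u x + w₃ α r s p q • rightA₂ α h r s u x

def aCoeff (p q r s : ℤ) : ℝ := (r : ℝ) * s - (p : ℝ) * q

def bCoeff (α : ℝ) (p q r s : ℤ) : ℝ :=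
  6 * (p : ℝ) * q * r * s * ((r : ℝ) + s - p - q)
    + 4 * α * ((r : ℝ) * s * ((r : ℝ) + s) - (p : ℝ) * q * ((p : ℝ) + q))
    + 9 * α * ((r : ℝ) * s - (p : ℝ) * q)

/-- `w_{p,q,r,s} = a b' / (a b' - a' b)`, where `a, b` belong to `(p, q, r, s)` and `a', b'` to
`(p', q', r', s')`; the companion weight `a' b / (a' b - a b')` is `w₄ α p' q' r' s' p q r s`. -/
def w₄ (α : ℝ) (p q r s p' q' r' s' : ℤ) : ℝ :=
  (aCoeff p q r s * bCoeff α p' q' r' s') /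
    (aCoeff p q r s * bCoeff α p' q' r' s' - aCoeff p' q' r' s' * bCoeff α p q r s)

def rightA₄ (α h : ℝ) (p q r s p' q' r' s' : ℤ) (u : ℝ → ℂ) (x : ℝ) : ℂ :=
  w₄ α p q r s p' q' r' s' • rightA₃ α h p q r s u x
    + w₄ α p' q' r' s' p q r s • rightA₃ α h p' q' r' s' u x

end

end WSLD

namespace WSLD

open Complex MeasureTheory Set Filter Asymptotics
open scoped Topology Real

/-! Everything becomes multiplication on the Fourier side. With `u(x) = (2π)⁻¹ ∫ e^{-iωx} û(ω) dω`,
the derivative of order `α` multiplies `û` by `(iω)^α`, and the operator with shift `j` multiplies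
it by `h^{-α} σ_j(ωh)`, where `σ_j(θ) = e^{ijθ} Q(e^{-iθ})` and `Q` is the generating function of
the absolutely summable `q_k`. For `z = iθ` near `0`, `σ_j = z^α e^{jz} W(z)^α` with `W(z) = (1 -
e^{-z})(3 - e^{-z})/(2z) = 1 - z²/3 + z³/4 + O(z⁴)`. The nested weights make the cubic Taylor
polynomials of `e^{jz} W^α` add up to `1` (`weights₄_taylorPoly`): each level cancels one more power
of `z`. So the weighted symbol differs from `(iθ)^α` by at most `C|θ|^{α+4}`
(`norm_sub_weights_shiftSymbol_le`), and `θ = ωh` gives the error `C h⁴ (2π)⁻¹ ∫ |ω|^{α+4} |û|`.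

It remains to justify the multiplier `(iω)^α` and the finiteness of that integral. The orders `α`
and `α + 4` share the kernel `(ξ - x)^{1-α}`, so a single function `J`, the kernel integral of `u`,
is differentiated twice or six times; existence for `α` follows. Damping the kernel shows that `J`
is the Fourier integral of `G(ω) = c (iω)^{α-2} û(ω)` (`setIntegral_kernel_smul`).

The delicate point is that `ω⁶ G` is integrable: `J` itself need not be, and its sixth derivative
exists only pointwise. But the sixth unit difference of `J` is both the Fourier integral of
`(e^{-iω} - 1)⁶ G` and a sixfold moving average of `J⁽⁶⁾ ∈ L¹`. Comparing transforms and cancelling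
the multiplier of the average gives `2π(-iω)⁶ G`, almost everywhere, as the transform of `J⁽⁶⁾`
(`ae_pow_mul_eq_fourierHat_iteratedDeriv`), which is integrable by hypothesis. -/

/-! ### Coefficients: summability and generating functions on the closed disc. -/

theorem choose_succ_eq (β : ℝ) (k : ℕ) :
    Ring.choose β (k + 1) = Ring.choose β k * ((β - k) / (k + 1)) := by
  have h1 := Ring.descPochhammer_eq_factorial_smul_choose β (k + 1)
  have h2 := Ring.descPochhammer_eq_factorial_smul_choose β k
  rw [descPochhammer_succ_right, Polynomial.smeval_mul, h2, nsmul_eq_mul, nsmul_eq_mul,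
    Nat.factorial_succ] at h1
  have h3 : (Polynomial.X - (k : Polynomial ℤ)).smeval β = β - k := by
    simp [Polynomial.smeval_sub, Polynomial.smeval_natCast]
  rw [h3] at h1
  have hk : ((k.factorial : ℕ) : ℝ) ≠ 0 := by positivity
  have hk' : (k : ℝ) + 1 ≠ 0 := by positivity
  push_cast at h1
  field_simp
  apply mul_left_cancel₀ hk
  linarith

theorem gCoeff_succ (α : ℝ) (k : ℕ) : gCoeff α (k + 1) = gCoeff α k * ((k - α) / (k + 1)) := by
  unfold gCoeff
  rw [choose_succ_eq, pow_succ]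
  ring

theorem gCoeff_zero (α : ℝ) : gCoeff α 0 = 1 := by simp [gCoeff]

theorem sum_gCoeff (α : ℝ) (n : ℕ) :
    ∑ k ∈ Finset.range (n + 1), gCoeff α k = gCoeff (α - 1) n := by
  induction n with
  | zero => simp [gCoeff]
  | succ n ih =>
    rw [Finset.sum_range_succ, ih]
    have h := Ring.choose_succ_succ (α - 1) n
    rw [sub_add_cancel] at h
    simp only [gCoeff, h, pow_succ]
    ring

theorem gCoeff_nonneg {α : ℝ} (h1 : 1 ≤ α) (h2 : α ≤ 2) (k : ℕ) : 0 ≤ gCoeff α (k + 2) := by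
  induction k with
  | zero =>
    rw [gCoeff_succ, gCoeff_succ, gCoeff_zero]
    norm_num
    nlinarith
  | succ k ih =>
    rw [gCoeff_succ]
    refine mul_nonneg ih (div_nonneg ?_ (by positivity))
    push_cast
    have : (0 : ℝ) ≤ k := by positivity
    linarith

theorem gCoeff_nonpos {β : ℝ} (h1 : 0 ≤ β) (h2 : β ≤ 1) (k : ℕ) : gCoeff β (k + 1) ≤ 0 := by
  induction k with
  | zero =>
    rw [gCoeff_succ, gCoeff_zero]
    norm_num
    exact h1
  | succ k ih =>
    rw [gCoeff_succ]
    refine mul_nonpos_of_nonpos_of_nonneg ih (div_nonneg ?_ (by positivity))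
    push_cast
    have : (0 : ℝ) ≤ k := by positivity
    linarith

/-- From index 2 on the terms are nonnegative, and the full partial sums are coefficients of `(1 -
ζ)^(α-1)`, hence nonpositive; so the tail is bounded by `-(g_0 + g_1)`. -/
theorem summable_abs_gCoeff {α : ℝ} (h1 : 1 ≤ α) (h2 : α ≤ 2) :
    Summable fun k => ‖gCoeff α k‖ := by
  rw [← summable_nat_add_iff 2]
  refine summable_of_sum_range_le (c := -(gCoeff α 0 + gCoeff α 1)) (fun _ => norm_nonneg _) ?_
  intro n
  have h := sum_gCoeff α (n + 1)
  rw [Finset.sum_range_succ', Finset.sum_range_succ'] at h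
  have h3 := gCoeff_nonpos (β := α - 1) (by linarith) (by linarith) n
  have h4 : ∀ i, ‖gCoeff α (i + 2)‖ = gCoeff α (i + 1 + 1) := fun i => by
    rw [Real.norm_eq_abs, abs_of_nonneg (gCoeff_nonneg h1 h2 i)]
  simp only [h4]
  simp only [zero_add] at h
  linarith

theorem hasSum_gCoeff_of_norm_lt_one (α : ℝ) {ζ : ℂ} (hζ : ‖ζ‖ < 1) :
    HasSum (fun k : ℕ => (gCoeff α k : ℂ) * ζ ^ k) ((1 - ζ) ^ (α : ℂ)) := by
  have h := (Complex.one_add_cpow_hasFPowerSeriesOnBall_zero (a := (α : ℂ))).hasSum (y := -ζ)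
    (by rw [← ENNReal.ofReal_one, Metric.eball_ofReal]; simpa using hζ)
  simp only [binomialSeries_apply, List.ofFn_const, List.prod_replicate, smul_eq_mul,
    ← sub_eq_add_neg] at h
  have e : (fun k : ℕ => (gCoeff α k : ℂ) * ζ ^ k) =
      fun k : ℕ => Ring.choose (α : ℂ) k * (-ζ) ^ k := by
    funext k
    rw [gCoeff, neg_pow ζ, ← Complex.ofReal_choose]
    push_cast
    ring
  rw [e, sub_eq_add_neg]
  simpa using h

/-- Radial limit `r → 1⁻` of the identity in the open disc: absolute summability dominates the
series, and `1 - ζ` avoids the branch cut. -/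
theorem hasSum_gCoeff {α : ℝ} (h1 : 1 ≤ α) (h2 : α ≤ 2) {ζ : ℂ} (hζ : ‖ζ‖ ≤ 1) (hζ1 : ζ ≠ 1) :
    HasSum (fun k : ℕ => (gCoeff α k : ℂ) * ζ ^ k) ((1 - ζ) ^ (α : ℂ)) := by
  have hs := summable_abs_gCoeff h1 h2
  have hb : ∀ k : ℕ, ∀ r : ℝ, r ∈ Ioo (0 : ℝ) 1 →
      ‖(gCoeff α k : ℂ) * ((r : ℂ) * ζ) ^ k‖ ≤ ‖gCoeff α k‖ := by
    intro k r hr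
    rw [norm_mul, norm_pow, norm_mul, norm_real, norm_real]
    refine mul_le_of_le_one_right (norm_nonneg _) (pow_le_one₀ (by positivity) ?_)
    rw [Real.norm_of_nonneg hr.1.le]
    exact mul_le_one₀ hr.2.le (norm_nonneg _) hζ
  have hsum : Summable (fun k : ℕ => (gCoeff α k : ℂ) * ζ ^ k) := by
    refine Summable.of_norm_bounded hs fun k => ?_
    rw [norm_mul, norm_pow, norm_real]
    exact mul_le_of_le_one_right (norm_nonneg _) (pow_le_one₀ (by positivity) hζ)
  have hIoo : ∀ᶠ r : ℝ in 𝓝[<] 1, r ∈ Ioo (0 : ℝ) 1 :=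
    Ioo_mem_nhdsLT zero_lt_one
  have hr : Tendsto (fun r : ℝ => (r : ℂ) * ζ) (𝓝[<] 1) (𝓝 ζ) := by
    have : Continuous fun r : ℝ => (r : ℂ) * ζ := by fun_prop
    simpa using (this.tendsto 1).mono_left nhdsWithin_le_nhds
  have hlim1 : Tendsto (fun r : ℝ => ∑' k : ℕ, (gCoeff α k : ℂ) * ((r : ℂ) * ζ) ^ k) (𝓝[<] 1)
      (𝓝 (∑' k : ℕ, (gCoeff α k : ℂ) * ζ ^ k)) := by
    refine tendsto_tsum_of_dominated_convergence hs (fun k => ?_) ?_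
    · exact (hr.pow k).const_mul _
    · filter_upwards [hIoo] with r hr k using hb k r hr
  have hslit : 1 - ζ ∈ slitPlane := by
    left
    have hre : ζ.re ≤ 1 := (re_le_norm ζ).trans hζ
    rcases hre.lt_or_eq with h | h
    · simpa using h
    · exfalso
      apply hζ1
      have h3 : ‖ζ‖ = ζ.re := le_antisymm (h ▸ hζ) (re_le_norm ζ)
      have h4 := Complex.sq_norm_sub_sq_re ζ
      rw [h3, sub_self] at h4
      apply Complex.ext
      · simpa using h
      · simpa using (pow_eq_zero_iff two_ne_zero).1 h4.symm
  have hlim2 : Tendsto (fun r : ℝ => ∑' k : ℕ, (gCoeff α k : ℂ) * ((r : ℂ) * ζ) ^ k) (𝓝[<] 1)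
      (𝓝 ((1 - ζ) ^ (α : ℂ))) := by
    have h5 : Tendsto (fun r : ℝ => (1 - (r : ℂ) * ζ) ^ (α : ℂ)) (𝓝[<] 1)
        (𝓝 ((1 - ζ) ^ (α : ℂ))) :=
      ((continuousAt_cpow_const hslit).tendsto).comp (hr.const_sub 1)
    refine h5.congr' ?_
    filter_upwards [hIoo] with r hr
    refine (hasSum_gCoeff_of_norm_lt_one α ?_).tsum_eq.symm
    rw [norm_mul, norm_real, Real.norm_of_nonneg hr.1.le]
    exact (mul_le_of_le_one_right hr.1.le hζ).trans_lt hr.2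
  rw [← tendsto_nhds_unique hlim1 hlim2]
  exact hsum.hasSum

theorem summable_abs_gCoeff_div {α : ℝ} (h1 : 1 ≤ α) (h2 : α ≤ 2) :
    Summable fun k : ℕ => ‖((3 : ℝ) ^ k)⁻¹ * gCoeff α k‖ := by
  refine Summable.of_nonneg_of_le (fun _ => norm_nonneg _) (fun k => ?_)
    (summable_abs_gCoeff h1 h2)
  rw [norm_mul]
  refine mul_le_of_le_one_left (norm_nonneg _) ?_
  rw [Real.norm_of_nonneg (by positivity)]
  exact inv_le_one_of_one_le₀ (one_le_pow₀ (by norm_num))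

theorem summable_abs_qCoeff {α : ℝ} (h1 : 1 ≤ α) (h2 : α ≤ 2) :
    Summable fun k => ‖qCoeff α k‖ := by
  have h := summable_norm_sum_mul_range_of_summable_norm (summable_abs_gCoeff_div h1 h2)
    (summable_abs_gCoeff h1 h2)
  simp only [qCoeff, norm_mul]
  exact h.mul_left _

/-- The generating function of `qCoeff α` on the closed unit disc. -/
noncomputable def qSymbol (α : ℝ) (ζ : ℂ) : ℂ :=
  ((3 / 2 : ℝ) ^ α : ℝ) * ((1 - ζ / 3) ^ (α : ℂ) * (1 - ζ) ^ (α : ℂ))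

theorem hasSum_qCoeff {α : ℝ} (h1 : 1 ≤ α) (h2 : α ≤ 2) {ζ : ℂ} (hζ : ‖ζ‖ ≤ 1) (hζ1 : ζ ≠ 1) :
    HasSum (fun k : ℕ => (qCoeff α k : ℂ) * ζ ^ k) (qSymbol α ζ) := by
  have hg := hasSum_gCoeff h1 h2 hζ hζ1
  have hζ3 : ‖ζ / 3‖ < 1 := by
    rw [norm_div]; norm_num; linarith
  have hg3 := hasSum_gCoeff_of_norm_lt_one α hζ3
  have hn : ∀ {ξ : ℂ}, ‖ξ‖ ≤ 1 → Summable fun k : ℕ => ‖(gCoeff α k : ℂ) * ξ ^ k‖ := by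
    intro ξ hξ
    refine Summable.of_nonneg_of_le (fun _ => norm_nonneg _) (fun k => ?_)
      (summable_abs_gCoeff h1 h2)
    rw [norm_mul, norm_pow, norm_real]
    exact mul_le_of_le_one_right (norm_nonneg _) (pow_le_one₀ (by positivity) hξ)
  have hsum := (summable_norm_sum_mul_range_of_summable_norm (hn hζ3.le) (hn hζ)).of_norm.hasSum
  rw [← tsum_mul_tsum_eq_tsum_sum_range_of_summable_norm (hn hζ3.le) (hn hζ), hg.tsum_eq,
    hg3.tsum_eq] at hsum
  have := hsum.mul_left ((((3 / 2 : ℝ) ^ α : ℝ)) : ℂ)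
  refine Eq.mp (congrArg (HasSum · _) (funext fun k => ?_)) this
  symm
  rw [qCoeff]
  push_cast
  rw [mul_assoc, Finset.sum_mul]
  congr 1
  refine Finset.sum_congr rfl fun m hm => ?_
  have hmk : m + (k - m) = k := Nat.add_sub_of_le (Finset.mem_range_succ_iff.1 hm)
  have hpow : ζ ^ k = ζ ^ m * ζ ^ (k - m) := by rw [← pow_add, hmk]
  rw [div_pow, hpow]
  ring

/-! ### Symbols, and weights as finitely supported functions of the shift. -/

/-- The symbol of the right Lubich operator with shift `j` at step `1`. -/
noncomputable def shiftSymbol (α : ℝ) (j : ℤ) (θ : ℝ) : ℂ :=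
  cexp (I * j * θ) * qSymbol α (cexp (-(I * θ)))

/-- Keeping the weights as a formal combination of shifts lets the same object be evaluated on
operators, on symbols and on Taylor polynomials, and allows shifts to coincide. -/
noncomputable def weights₂ (p q : ℤ) : ℤ →₀ ℂ :=
  w₂ p q • Finsupp.single p 1 + w₂ q p • Finsupp.single q 1

noncomputable def weights₃ (α : ℝ) (p q r s : ℤ) : ℤ →₀ ℂ :=
  w₃ α p q r s • weights₂ p q + w₃ α r s p q • weights₂ r s

noncomputable def weights₄ (α : ℝ) (p q r s p' q' r' s' : ℤ) : ℤ →₀ ℂ :=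
  w₄ α p q r s p' q' r' s' • weights₃ α p q r s + w₄ α p' q' r' s' p q r s • weights₃ α p' q' r' s'

theorem rightA₄_eq (α h : ℝ) (p q r s p' q' r' s' : ℤ) (u : ℝ → ℂ) (x : ℝ) :
    rightA₄ α h p q r s p' q' r' s' u x =
      Finsupp.linearCombination ℂ (fun j => rightA α h j u x) (weights₄ α p q r s p' q' r' s') := by
  simp only [rightA₄, rightA₃, rightA₂, weights₄, weights₃, weights₂, map_add,
    LinearMap.map_smul_of_tower, Finsupp.linearCombination_single, one_smul]

/-- The third Taylor polynomial of the normalised shifted symbol. -/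
noncomputable def taylorPoly (α : ℝ) (z : ℂ) (j : ℤ) : ℂ :=
  1 + j * z + ((j : ℂ) ^ 2 / 2 - α / 3) * z ^ 2 + ((j : ℂ) ^ 3 / 6 - j * α / 3 + α / 4) * z ^ 3

/-- The linear term is gone. The next two levels cancel the `z²` and then the `z³` coefficient. -/
theorem weights₂_taylorPoly (α : ℝ) {p q : ℤ} (hpq : p ≠ q) (z : ℂ) :
    Finsupp.linearCombination ℂ (taylorPoly α z) (weights₂ p q) =
      1 + (-(p * q : ℂ) / 2 - α / 3) * z ^ 2 + (-(p * q * (p + q) : ℂ) / 6 + α / 4) * z ^ 3 := by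
  have h1 : (q : ℂ) - p ≠ 0 := sub_ne_zero.2 (by exact_mod_cast hpq.symm)
  have h2 : (p : ℂ) - q ≠ 0 := sub_ne_zero.2 (by exact_mod_cast hpq)
  have h3 : (p : ℂ) - q = -(q - p) := by ring
  simp only [weights₂, map_add, LinearMap.map_smul_of_tower, Finsupp.linearCombination_single,
    one_smul, w₂, real_smul, taylorPoly]
  push_cast
  rw [h3]
  field_simp
  ring

theorem weights₃_taylorPoly (α : ℝ) {p q r s : ℤ} (hpq : p ≠ q) (hrs : r ≠ s)
    (hpqrs : r * s ≠ p * q) (z : ℂ) :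
    Finsupp.linearCombination ℂ (taylorPoly α z) (weights₃ α p q r s) =
      1 + bCoeff α p q r s / (36 * aCoeff p q r s) * z ^ 3 := by
  have h1 : (r : ℂ) * s - p * q ≠ 0 := sub_ne_zero.2 (by exact_mod_cast hpqrs)
  have h3 : (p : ℂ) * q - r * s = -(r * s - p * q) := by ring
  simp only [weights₃, map_add, LinearMap.map_smul_of_tower, weights₂_taylorPoly α hpq,
    weights₂_taylorPoly α hrs, w₃, real_smul, aCoeff, bCoeff]
  push_cast
  rw [h3]
  field_simp
  ring

theorem weights₄_taylorPoly (α : ℝ) {p q r s p' q' r' s' : ℤ}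
    (hpq : p ≠ q) (hrs : r ≠ s) (hpq' : p' ≠ q') (hrs' : r' ≠ s')
    (hpqrs : r * s ≠ p * q) (hpqrs' : r' * s' ≠ p' * q')
    (hab : aCoeff p q r s * bCoeff α p' q' r' s' ≠ aCoeff p' q' r' s' * bCoeff α p q r s) (z : ℂ) :
    Finsupp.linearCombination ℂ (taylorPoly α z) (weights₄ α p q r s p' q' r' s') = 1 := by
  have ha : (aCoeff p q r s : ℂ) ≠ 0 := by
    rw [aCoeff]; push_cast; exact sub_ne_zero.2 (by exact_mod_cast hpqrs)
  have ha' : (aCoeff p' q' r' s' : ℂ) ≠ 0 := by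
    rw [aCoeff]; push_cast; exact sub_ne_zero.2 (by exact_mod_cast hpqrs')
  have hd : (aCoeff p q r s : ℂ) * bCoeff α p' q' r' s' -
      aCoeff p' q' r' s' * bCoeff α p q r s ≠ 0 := sub_ne_zero.2 (by exact_mod_cast hab)
  have h3 : (aCoeff p' q' r' s' : ℂ) * bCoeff α p q r s -
      aCoeff p q r s * bCoeff α p' q' r' s' = -((aCoeff p q r s : ℂ) * bCoeff α p' q' r' s' -
      aCoeff p' q' r' s' * bCoeff α p q r s) := by ring
  simp only [weights₄, map_add, LinearMap.map_smul_of_tower, weights₃_taylorPoly α hpq hrs hpqrs,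
    weights₃_taylorPoly α hpq' hrs' hpqrs', w₄, real_smul]
  push_cast
  rw [h3]
  field_simp
  ring

/-! ### Expansion of the symbol at the origin and the global symbol bound. -/

/-- The arguments lie in `[-π/2, π/2]` and `(-π/2, π/2)`, so their sum stays inside the principal
range. The weak inequality on `x` admits the imaginary axis, where the symbols live. -/
theorem mul_cpow_of_re_nonneg {x y : ℂ} (hx0 : x ≠ 0) (hx : 0 ≤ x.re) (hy : 0 < y.re) (a : ℂ) :
    (x * y) ^ a = x ^ a * y ^ a := by
  have hy0 : y ≠ 0 := fun h => by simp [h] at hy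
  have h1 := abs_le.1 (abs_arg_le_pi_div_two_iff.2 hx)
  have h2 := abs_lt.1 (abs_arg_lt_pi_div_two_iff.2 (Or.inl hy))
  rw [cpow_def_of_ne_zero (mul_ne_zero hx0 hy0), cpow_def_of_ne_zero hx0, cpow_def_of_ne_zero hy0,
    log_mul hx0 hy0 ⟨by linarith, by linarith⟩, add_mul, exp_add]

/-- The base `(1 - e^{-z})(3 - e^{-z}) / (2z)` of the normalised generating function. -/
noncomputable def symbolBase (z : ℂ) : ℂ := (3 - 4 * cexp (-z) + cexp (-(2 * z))) / (2 * z)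

theorem exp_mul_isBigO (c : ℂ) (n : ℕ) :
    (fun z : ℂ => cexp (c * z) - ∑ i ∈ Finset.range n, (c * z) ^ i / i.factorial)
      =O[𝓝 0] fun z => z ^ n := by
  have ht : Tendsto (fun z : ℂ => c * z) (𝓝 0) (𝓝 0) := by
    have : Continuous fun z : ℂ => c * z := by fun_prop
    simpa using this.tendsto 0
  refine ((Complex.exp_sub_sum_range_isBigO_pow n).comp_tendsto ht).trans ?_
  simp only [Function.comp_def, mul_pow]
  exact isBigO_const_mul_self _ _ _

theorem symbolBase_isBigO :
    (fun z : ℂ => symbolBase z - (1 - z ^ 2 / 3 + z ^ 3 / 4)) =O[𝓝[≠] 0] fun z => z ^ 4 := by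
  -- Order 5 in the numerator, since division by `2z` costs one power.
  have h1 := ((exp_mul_isBigO (-1) 5).const_mul_left (-4)).add (exp_mul_isBigO (-2) 5)
  have h2 := (h1.mono (nhdsWithin_le_nhds (s := {0}ᶜ))).mul (isBigO_refl (fun z : ℂ => z⁻¹) _)
  have h3 := h2.const_mul_left (1 / 2)
  refine (h3.congr' ?_ ?_)
  · filter_upwards [self_mem_nhdsWithin] with z hz
    have hz' : z ≠ 0 := hz
    simp only [Finset.sum_range_succ, Finset.sum_range_zero, symbolBase]
    norm_num [Nat.factorial]
    field_simp
    ring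
  · filter_upwards [self_mem_nhdsWithin] with z hz
    have hz' : z ≠ 0 := hz
    field_simp

theorem pow_mul_isBigO {g : ℂ → ℂ} (hg : Continuous g) (n : ℕ) :
    (fun z => z ^ n * g z) =O[𝓝[≠] 0] fun z => z ^ n := by
  have h : g =O[𝓝[≠] 0] fun _ => (1 : ℂ) :=
    ((hg.tendsto 0).isBigO_one ℂ).mono nhdsWithin_le_nhds
  simpa using (isBigO_refl (fun z : ℂ => z ^ n) (𝓝[≠] 0)).mul h

theorem symbolBase_sub_one_isBigO :
    (fun z : ℂ => symbolBase z - 1) =O[𝓝[≠] 0] fun z => z ^ 2 := by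
  have h1 : (fun z : ℂ => z ^ 4) =O[𝓝[≠] 0] fun z : ℂ => z ^ 2 := by
    refine (pow_mul_isBigO (g := fun z => z ^ 2) (by fun_prop) 2).congr_left fun z => ?_
    ring
  have h2 := (symbolBase_isBigO.trans h1).add
    (pow_mul_isBigO (g := fun z => -1 / 3 + z / 4) (by fun_prop) 2)
  refine h2.congr_left fun z => ?_
  ring

theorem symbolBase_cpow_isBigO (α : ℝ) :
    (fun z : ℂ => symbolBase z ^ (α : ℂ) - (1 - α * z ^ 2 / 3 + α * z ^ 3 / 4))
      =O[𝓝[≠] 0] fun z => z ^ 4 := by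
  have h0 : Tendsto (fun z : ℂ => symbolBase z - 1) (𝓝[≠] 0) (𝓝 0) := by
    refine symbolBase_sub_one_isBigO.trans_tendsto ?_
    have : Continuous fun z : ℂ => z ^ 2 := by fun_prop
    simpa using (this.tendsto 0).mono_left nhdsWithin_le_nhds
  have h1 := ((Complex.one_add_cpow_hasFPowerSeriesAt_zero
    (a := (α : ℂ))).isBigO_sub_partialSum_pow 2).comp_tendsto h0
  -- With `w = W - 1 = O(z²)`, the remainder `O(w²)` of `(1 + w)^α = 1 + αw + O(w²)` is already
  -- `O(z⁴)`.
  have h2 := h1.trans ((symbolBase_sub_one_isBigO.norm_left).pow 2)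
  have h3 := h2.congr_right (g₂ := fun z => z ^ 4) (fun z => by ring)
  refine (h3.add (symbolBase_isBigO.const_mul_left α)).congr_left fun z => ?_
  simp only [Function.comp, FormalMultilinearSeries.partialSum, Finset.sum_range_succ,
    Finset.sum_range_zero, binomialSeries_apply, List.ofFn_const, List.prod_replicate,
    Ring.choose_zero_right, Ring.choose_one_right, smul_eq_mul, zero_add, pow_zero, pow_one,
    mul_one, add_sub_cancel]
  ring

theorem exp_mul_symbolBase_cpow_isBigO (α : ℝ) (j : ℤ) :
    (fun z : ℂ => cexp (j * z) * symbolBase z ^ (α : ℂ) - taylorPoly α z j)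
      =O[𝓝[≠] 0] fun z => z ^ 4 := by
  have hb : (fun z : ℂ => cexp (j * z)) =O[𝓝[≠] 0] fun _ => (1 : ℂ) := by
    have : Continuous fun z : ℂ => cexp (j * z) := by fun_prop
    exact ((this.tendsto 0).isBigO_one ℂ).mono nhdsWithin_le_nhds
  have hb' : (fun z : ℂ => 1 - α * z ^ 2 / 3 + α * z ^ 3 / 4) =O[𝓝[≠] 0] fun _ => (1 : ℂ) := by
    have : Continuous fun z : ℂ => 1 - α * z ^ 2 / 3 + α * z ^ 3 / 4 := by fun_prop
    exact ((this.tendsto 0).isBigO_one ℂ).mono nhdsWithin_le_nhds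
  have h1 := hb.mul (symbolBase_cpow_isBigO α)
  have h2 := ((exp_mul_isBigO j 4).mono (nhdsWithin_le_nhds (s := {0}ᶜ))).mul hb'
  simp only [one_mul, mul_one] at h1 h2
  -- The terms of degree at least 4 in the product of the two cubic truncations, divided by `z⁴`.
  have h3 := pow_mul_isBigO (g := fun z => j * (α / 4) - (j : ℂ) ^ 2 / 2 * (α / 3)
    + ((j : ℂ) ^ 2 / 2 * (α / 4) - (j : ℂ) ^ 3 / 6 * (α / 3)) * z
    + (j : ℂ) ^ 3 / 6 * (α / 4) * z ^ 2) (by fun_prop) 4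
  refine ((h1.add h2).add h3).congr_left fun z => ?_
  simp only [Finset.sum_range_succ, Finset.sum_range_zero, taylorPoly]
  norm_num [Nat.factorial]
  ring

theorem symbolFactor_re_pos :
    ∀ᶠ z : ℂ in 𝓝[≠] 0, 0 < ((1 - cexp (-z)) / z).re ∧ 0 < (1 - cexp (-z) / 3).re := by
  have hd : HasDerivAt (fun z : ℂ => 1 - cexp (-z)) 1 0 := by
    have := ((hasDerivAt_id (0 : ℂ)).neg.cexp).const_sub 1
    simpa using this
  have h1 : Tendsto (fun z : ℂ => (1 - cexp (-z)) / z) (𝓝[≠] 0) (𝓝 1) := by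
    refine (hasDerivAt_iff_tendsto_slope.1 hd).congr fun z => ?_
    simp [slope, div_eq_inv_mul]
  have h2 : Tendsto (fun z : ℂ => 1 - cexp (-z) / 3) (𝓝[≠] 0) (𝓝 (1 - 1 / 3)) := by
    have : Continuous fun z : ℂ => 1 - cexp (-z) / 3 := by fun_prop
    simpa using (this.tendsto 0).mono_left nhdsWithin_le_nhds
  have h3 := (continuous_re.tendsto _).comp h1
  have h4 := (continuous_re.tendsto _).comp h2
  exact (h3.eventually_const_lt (by simp)).and (h4.eventually_const_lt (by norm_num))

/-- The factors `(1 - e^{-z})/z` and `1 - e^{-z}/3` tend to `1` and `2/3`, so near `0` all powers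
split without crossing the branch cut. -/
theorem qSymbol_exp_eq (α : ℝ) : ∀ᶠ z : ℂ in 𝓝[≠] 0, 0 ≤ z.re →
    qSymbol α (cexp (-z)) = z ^ (α : ℂ) * symbolBase z ^ (α : ℂ) := by
  filter_upwards [symbolFactor_re_pos, self_mem_nhdsWithin] with z ⟨hz1, hz2⟩ hz0 hre
  have hz0' : z ≠ 0 := hz0
  have h1 : 1 - cexp (-z) = z * ((1 - cexp (-z)) / z) := by field_simp
  have h2 : symbolBase z =
      ((1 - cexp (-z)) / z) * (((3 / 2 : ℝ) : ℂ) * (1 - cexp (-z) / 3)) := by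
    have h3 : cexp (-(2 * z)) = cexp (-z) * cexp (-z) := by rw [← exp_add]; ring_nf
    rw [symbolBase, h3]
    push_cast
    field_simp
    ring
  have h4 : 0 < (((3 / 2 : ℝ) : ℂ) * (1 - cexp (-z) / 3)).re := by
    rw [re_ofReal_mul]; positivity
  rw [qSymbol, h2, mul_cpow_of_re_nonneg (fun h => by simp [h] at hz1) hz1.le h4,
    mul_cpow_of_re_nonneg (by norm_num) (by rw [ofReal_re]; norm_num) hz2]
  have h5 : (1 - cexp (-z)) ^ (α : ℂ) = z ^ (α : ℂ) * ((1 - cexp (-z)) / z) ^ (α : ℂ) := by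
    rw [← mul_cpow_of_re_nonneg hz0' hre hz1, ← h1]
  rw [h5, ofReal_cpow (by norm_num)]
  ring

theorem norm_shiftSymbol_le {α : ℝ} (hα : 0 ≤ α) (j : ℤ) (θ : ℝ) :
    ‖shiftSymbol α j θ‖ ≤ (3 / 2 : ℝ) ^ α * (2 ^ α * 2 ^ α) := by
  have h1 : ‖cexp (I * j * θ)‖ = 1 := by
    rw [show I * (j : ℂ) * θ = ((j * θ : ℝ) : ℂ) * I by push_cast; ring, norm_exp_ofReal_mul_I]
  have h2 : ‖cexp (-(I * θ))‖ = 1 := by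
    rw [show -(I * (θ : ℂ)) = ((-θ : ℝ) : ℂ) * I by push_cast; ring, norm_exp_ofReal_mul_I]
  rw [shiftSymbol, qSymbol, norm_mul, h1, one_mul, norm_mul, norm_mul, norm_real,
    Real.norm_of_nonneg (by positivity), norm_cpow_real, norm_cpow_real]
  gcongr
  · refine (norm_sub_le _ _).trans ?_
    rw [norm_div, h2]; norm_num
  · refine (norm_sub_le _ _).trans ?_
    rw [h2]; norm_num

theorem shiftSymbol_isBigO (α : ℝ) (j : ℤ) :
    (fun θ : ℝ => shiftSymbol α j θ - (I * θ) ^ (α : ℂ) * taylorPoly α (I * θ) j)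
      =O[𝓝[≠] 0] fun θ => |θ| ^ (α + 4) := by
  have ht : Tendsto (fun θ : ℝ => I * (θ : ℂ)) (𝓝[≠] 0) (𝓝[≠] 0) := by
    refine tendsto_nhdsWithin_iff.2 ⟨?_, ?_⟩
    · have : Continuous fun θ : ℝ => I * (θ : ℂ) := by fun_prop
      simpa using (this.tendsto 0).mono_left nhdsWithin_le_nhds
    · filter_upwards [self_mem_nhdsWithin] with θ hθ
      have : θ ≠ 0 := hθ
      simpa using this
  have h1 := (exp_mul_symbolBase_cpow_isBigO α j).comp_tendsto ht
  have h2 := (isBigO_refl (fun θ : ℝ => (I * (θ : ℂ)) ^ (α : ℂ)) (𝓝[≠] 0)).mul h1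
  refine IsBigO.congr' h2.norm_right ?_ ?_
  · filter_upwards [ht.eventually (qSymbol_exp_eq α)] with θ hθ
    rw [shiftSymbol, hθ (by simp)]
    simp only [Function.comp]
    rw [show I * (j : ℂ) * θ = j * (I * θ) by ring]
    ring
  · filter_upwards [self_mem_nhdsWithin] with θ hθ
    have hθ' : θ ≠ 0 := hθ
    simp only [Function.comp, norm_mul, norm_pow, norm_cpow_real, norm_I, one_mul, norm_real,
      Real.norm_eq_abs]
    rw [Real.rpow_add (abs_pos.2 hθ')]
    norm_cast

theorem norm_sub_weights_shiftSymbol_le {α : ℝ} (hα : 0 ≤ α) {c : ℤ →₀ ℂ}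
    (hc : ∀ z, Finsupp.linearCombination ℂ (taylorPoly α z) c = 1) :
    ∃ C : ℝ, ∀ θ : ℝ, θ ≠ 0 → ‖(I * θ) ^ (α : ℂ) -
      Finsupp.linearCombination ℂ (fun j => shiftSymbol α j θ) c‖ ≤ C * |θ| ^ (α + 4) := by
  have h1 : (fun θ : ℝ => (I * θ) ^ (α : ℂ) -
      Finsupp.linearCombination ℂ (fun j => shiftSymbol α j θ) c) =O[𝓝[≠] 0]
      fun θ => |θ| ^ (α + 4) := by
    have h2 : (fun θ : ℝ => ∑ j ∈ c.support, c j *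
        (shiftSymbol α j θ - (I * θ) ^ (α : ℂ) * taylorPoly α (I * θ) j)) =O[𝓝[≠] 0]
        fun θ => |θ| ^ (α + 4) := by
      simpa only [Finset.sum_fn] using
        IsBigO.sum fun j _ => (shiftSymbol_isBigO α j).const_mul_left (c j)
    refine h2.neg_left.congr_left fun θ => ?_
    have h3 := hc (I * θ)
    rw [Finsupp.linearCombination_apply, Finsupp.sum] at h3 ⊢
    simp only [smul_eq_mul, mul_sub, Finset.sum_sub_distrib] at h3 ⊢
    have h4 : ∑ j ∈ c.support, c j * ((I * θ) ^ (α : ℂ) * taylorPoly α (I * θ) j) =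
        (I * θ) ^ (α : ℂ) := by
      trans (I * θ) ^ (α : ℂ) * ∑ j ∈ c.support, c j * taylorPoly α (I * θ) j
      · rw [Finset.mul_sum]
        exact Finset.sum_congr rfl fun j _ => by ring
      · rw [h3, mul_one]
    rw [h4]
    ring
  obtain ⟨C₁, hC₁⟩ := h1.bound
  rw [eventually_nhdsWithin_iff, Metric.eventually_nhds_iff] at hC₁
  obtain ⟨δ, hδ, hC₁⟩ := hC₁
  set B := ∑ j ∈ c.support, ‖c j‖ * ((3 / 2 : ℝ) ^ α * (2 ^ α * 2 ^ α)) with hB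
  have hB0 : 0 ≤ B := Finset.sum_nonneg fun j _ => by positivity
  -- `C₁` serves `|θ| < δ`. For `|θ| ≥ δ`, the terms `|θ|^α` and `B` are compared separately with
  -- `|θ|^{α+4}`.
  refine ⟨max C₁ ((δ ^ 4)⁻¹ + B * (δ ^ (α + 4))⁻¹), fun θ hθ => ?_⟩
  have hp : 0 < |θ| := abs_pos.2 hθ
  rcases lt_or_ge |θ| δ with h | h
  · refine (hC₁ (by simpa using h) hθ).trans ?_
    rw [Real.norm_of_nonneg (by positivity)]
    exact mul_le_mul_of_nonneg_right (le_max_left _ _) (by positivity)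
  · refine le_trans ?_ (mul_le_mul_of_nonneg_right (le_max_right _ _) (by positivity))
    refine (norm_sub_le _ _).trans ?_
    rw [add_mul]
    refine add_le_add ?_ ?_
    · rw [norm_cpow_real, norm_mul, norm_I, one_mul, norm_real, Real.norm_eq_abs,
        Real.rpow_add hp, mul_comm (|θ| ^ α), ← mul_assoc]
      refine le_mul_of_one_le_left (by positivity) ?_
      rw [inv_mul_eq_div, one_le_div (by positivity)]
      norm_cast
      gcongr
    · have h5 : ‖Finsupp.linearCombination ℂ (fun j => shiftSymbol α j θ) c‖ ≤ B := by
        rw [Finsupp.linearCombination_apply, Finsupp.sum]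
        refine norm_sum_le_of_le _ fun j _ => ?_
        rw [norm_smul]
        exact mul_le_mul_of_nonneg_left (norm_shiftSymbol_le hα j θ) (norm_nonneg _)
      refine h5.trans ?_
      rw [mul_assoc]
      refine le_mul_of_one_le_right hB0 ?_
      rw [inv_mul_eq_div, one_le_div (by positivity)]
      gcongr

/-! ### Laplace transform of a power at a complex parameter. -/

open ProbabilityTheory in
/-- The Laplace transform of a power function at a complex parameter in the right half-plane. -/
theorem integral_rpow_mul_cexp_neg_mul_Ioi {γ : ℝ} (hγ : 0 < γ) {r : ℂ} (hr : 0 < r.re) :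
    ∫ t in Ioi (0 : ℝ), ((t ^ (γ - 1) : ℝ) : ℂ) * cexp (-(r * t)) =
      (1 / r) ^ (γ : ℂ) * Complex.Gamma γ := by
  have hmeas : Measurable fun t : ℝ => Real.toNNReal (t ^ (γ - 1)) := by fun_prop
  -- The integral is the complex moment generating function of `t^(γ-1) dt` at `-r`, which is
  -- analytic for `Re r > 0`. The identity theorem then extends the formula from real `r > 1`,
  -- accumulating at `1`.
  set μ : Measure ℝ := (volume.restrict (Ioi 0)).withDensity
    (fun t => (Real.toNNReal (t ^ (γ - 1)) : ENNReal)) with hμ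
  have hmgf : ∀ z : ℂ, complexMGF id μ z =
      ∫ t in Ioi (0 : ℝ), ((t ^ (γ - 1) : ℝ) : ℂ) * cexp (z * t) := by
    intro z
    rw [complexMGF, hμ, integral_withDensity_eq_integral_smul hmeas]
    refine setIntegral_congr_fun measurableSet_Ioi fun t ht => ?_
    have : (0 : ℝ) ≤ t ^ (γ - 1) := Real.rpow_nonneg (le_of_lt ht) _
    simp only [NNReal.smul_def, Real.coe_toNNReal _ this, id, real_smul]
  have hsub : Iio 0 ⊆ integrableExpSet id μ := by
    intro a ha
    change Integrable _ _
    rw [hμ, integrable_withDensity_iff_integrable_coe_smul hmeas]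
    have h1 := integrableOn_rpow_mul_exp_neg_mul_rpow (p := 1) (s := γ - 1) (b := -a)
      (by linarith) one_pos (by simpa using ha)
    refine IntegrableOn.congr_fun h1 (fun t ht => ?_) measurableSet_Ioi
    have : (0 : ℝ) ≤ t ^ (γ - 1) := Real.rpow_nonneg (le_of_lt ht) _
    simp [Real.coe_toNNReal _ this]
  have hint : ∀ z : ℂ, 0 < z.re → (-z).re ∈ interior (integrableExpSet id μ) := fun z hz =>
    interior_maximal hsub isOpen_Iio (by simpa using hz)
  set U : Set ℂ := {z | 0 < z.re} with hU
  have hUo : IsOpen U := isOpen_lt continuous_const continuous_re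
  have hF : AnalyticOnNhd ℂ (fun z => complexMGF id μ (-z)) U := fun z hz =>
    (analyticAt_complexMGF (hint z hz)).fun_comp analyticAt_id.neg
  have hG : AnalyticOnNhd ℂ (fun z => (1 / z) ^ (γ : ℂ) * Complex.Gamma γ) U := by
    refine DifferentiableOn.analyticOnNhd (fun z hz => ?_) hUo
    have hz0 : z ≠ 0 := fun h => by simp [hU, h] at hz
    have hs : 1 / z ∈ slitPlane := by
      left
      rw [one_div, inv_re]
      exact div_pos hz (normSq_pos.2 hz0)
    have hd : DifferentiableAt ℂ (fun z : ℂ => 1 / z) z := by fun_prop (disch := assumption)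
    exact ((hd.cpow_const hs).mul_const _).differentiableWithinAt
  have hpre : IsPreconnected U := (convex_halfSpace_re_gt 0).isPreconnected
  have hfreq : ∃ᶠ z in 𝓝[≠] (1 : ℂ),
      complexMGF id μ (-z) = (1 / z) ^ (γ : ℂ) * Complex.Gamma γ := by
    have ht : Tendsto (fun x : ℝ => (x : ℂ)) (𝓝[>] 1) (𝓝[≠] 1) := by
      refine tendsto_nhdsWithin_iff.2 ⟨?_, ?_⟩
      · exact (continuous_ofReal.tendsto' 1 1 (by simp)).mono_left nhdsWithin_le_nhds
      · filter_upwards [self_mem_nhdsWithin] with x hx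
        have h1 : (1 : ℝ) < x := hx
        simpa using h1.ne'
    refine ht.frequently (Eventually.frequently ?_)
    filter_upwards [self_mem_nhdsWithin] with x hx
    have hx0 : (0 : ℝ) < x := zero_lt_one.trans hx
    rw [hmgf, ← integral_cpow_mul_exp_neg_mul_Ioi (by simpa using hγ) hx0]
    refine setIntegral_congr_fun measurableSet_Ioi fun t ht => ?_
    rw [ofReal_cpow (le_of_lt ht)]
    push_cast
    ring_nf
  have h := hF.eqOn_of_preconnected_of_frequently_eq hG hpre (z₀ := 1) (by simp [hU]) hfreq hr
  simp only [hmgf] at h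
  rw [← h]
  simp only [neg_mul]

/-! ### Fourier inversion in the present normalisation. -/

theorem norm_cexp_neg_I_mul (ω x : ℝ) : ‖cexp (-(I * ω * x))‖ = 1 := by
  rw [show -(I * (ω : ℂ) * x) = ((-(ω * x) : ℝ) : ℂ) * I by push_cast; ring, norm_exp_ofReal_mul_I]

theorem norm_cexp_I_mul (ω x : ℝ) : ‖cexp (I * ω * x)‖ = 1 := by
  rw [show I * (ω : ℂ) * x = ((ω * x : ℝ) : ℂ) * I by push_cast; ring, norm_exp_ofReal_mul_I]

/-- The Fourier transform with the opposite sign, `x ↦ ∫ e^{-iωx} G(ω) dω`. -/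
noncomputable def conjFourierHat (G : ℝ → ℂ) (x : ℝ) : ℂ :=
  ∫ ω : ℝ, cexp (-(I * ω * x)) * G ω

theorem conjFourierHat_eq (G : ℝ → ℂ) (x : ℝ) : conjFourierHat G x = fourierHat G (-x) := by
  refine integral_congr_ae (Eventually.of_forall fun ω => ?_)
  simp only
  congr 2
  push_cast
  ring

theorem integrable_cexp_mul {G : ℝ → ℂ} (hG : Integrable G) (x : ℝ) :
    Integrable fun ω : ℝ => cexp (-(I * ω * x)) * G ω := by
  refine hG.bdd_mul (c := 1) (Continuous.aestronglyMeasurable (by fun_prop)) ?_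
  exact Eventually.of_forall fun ω => (norm_cexp_neg_I_mul ω x).le

theorem norm_conjFourierHat_le (G : ℝ → ℂ) (x : ℝ) : ‖conjFourierHat G x‖ ≤ ∫ ω, ‖G ω‖ := by
  refine (norm_integral_le_integral_norm _).trans_eq ?_
  simp only [norm_mul, norm_cexp_neg_I_mul, one_mul]

theorem norm_fourierHat_le (f : ℝ → ℂ) (ω : ℝ) : ‖fourierHat f ω‖ ≤ ∫ x, ‖f x‖ := by
  have := norm_conjFourierHat_le f (-ω)
  rwa [conjFourierHat_eq, neg_neg] at this

theorem continuous_fourierHat {f : ℝ → ℂ} (hf : Integrable f) : Continuous (fourierHat f) := by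
  refine continuous_of_dominated (bound := fun x => ‖f x‖) ?_ ?_ hf.norm ?_
  · intro ω
    exact (Continuous.aestronglyMeasurable (by fun_prop)).mul hf.aestronglyMeasurable
  · intro ω
    exact Eventually.of_forall fun x => by rw [norm_mul, norm_cexp_I_mul, one_mul]
  · exact Eventually.of_forall fun x => by fun_prop

theorem conjFourierHat_fourierHat {f : ℝ → ℂ} (hf : Integrable f)
    (hf' : Integrable (fourierHat f)) {x : ℝ} (hx : ContinuousAt f x) :
    conjFourierHat (fourierHat f) x = 2 * π * f x := by
  have hpi : (2 * π : ℝ) ≠ 0 := by positivity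
  have hInv : ∀ v : ℝ, FourierTransformInv.fourierInv f v = fourierHat f (2 * π * v) := by
    intro v
    rw [Real.fourierInv_eq']
    refine integral_congr_ae (Eventually.of_forall fun y => ?_)
    simp only [smul_eq_mul, RCLike.inner_apply, conj_trivial]
    congr 2
    push_cast
    ring
  have hF : Integrable (FourierTransform.fourier f) := by
    have h : FourierTransform.fourier f = fun v => fourierHat f ((-(2 * π)) * v) := by
      funext v
      rw [← neg_neg v, ← Real.fourierInv_eq_fourier_neg, hInv]
      ring_nf
    rw [h]
    exact hf'.comp_mul_left' (neg_ne_zero.2 hpi)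
  have h := hf.fourier_fourierInv_eq hF hx
  rw [Real.fourier_eq'] at h
  have h2 : conjFourierHat (fourierHat f) x = |(2 * π)| • ∫ v : ℝ,
      cexp (((-2 * π * inner ℝ v x : ℝ) : ℂ) * I) • FourierTransformInv.fourierInv f v := by
    rw [conjFourierHat]
    have h3 := Measure.integral_comp_mul_left
      (fun ω : ℝ => cexp (-(I * ω * x)) * fourierHat f ω) (2 * π)
    rw [← inv_smul_eq_iff₀ (by positivity), ← abs_inv, ← h3]
    refine integral_congr_ae (Eventually.of_forall fun y => ?_)
    simp only [smul_eq_mul, RCLike.inner_apply, conj_trivial, hInv]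
    congr 2
    push_cast
    ring
  rw [h2, h, abs_of_pos (by positivity), real_smul]
  push_cast
  ring

theorem fourierHat_conjFourierHat {G : ℝ → ℂ} (hG : Integrable G)
    (hG' : Integrable (conjFourierHat G)) {ω : ℝ} (hω : ContinuousAt G ω) :
    fourierHat (conjFourierHat G) ω = 2 * π * G ω := by
  have h1 : Integrable (fourierHat G) := by
    have := hG'.comp_neg
    simpa only [conjFourierHat_eq, neg_neg] using this
  rw [← conjFourierHat_fourierHat hG h1 hω, conjFourierHat, fourierHat, ← integral_neg_eq_self]
  refine integral_congr_ae (Eventually.of_forall fun x => ?_)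
  simp only [conjFourierHat_eq, neg_neg]
  congr 2
  push_cast
  ring

theorem hasDerivAt_conjFourierHat {G : ℝ → ℂ} (hG : Integrable G)
    (hG' : Integrable fun ω : ℝ => -(I * ω) * G ω) (x : ℝ) :
    HasDerivAt (conjFourierHat G) (conjFourierHat (fun ω : ℝ => -(I * ω) * G ω) x) x := by
  refine (hasDerivAt_integral_of_dominated_loc_of_deriv_le (𝕜 := ℝ) (μ := volume)
    (F := fun x ω => cexp (-(I * (ω : ℝ) * (x : ℝ))) * G ω)
    (F' := fun x ω => cexp (-(I * (ω : ℝ) * (x : ℝ))) * (-(I * (ω : ℝ)) * G ω))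
    (bound := fun ω => ‖-(I * (ω : ℝ)) * G ω‖)
    univ_mem (Eventually.of_forall fun y => (integrable_cexp_mul hG y).aestronglyMeasurable)
    (integrable_cexp_mul hG x) (integrable_cexp_mul hG' x).aestronglyMeasurable
    (Eventually.of_forall fun ω y _ => ?_) hG'.norm (Eventually.of_forall fun ω y _ => ?_)).2
  · rw [norm_mul, norm_cexp_neg_I_mul, one_mul]
  · have h1 : HasDerivAt (fun y : ℝ => -(I * (ω : ℝ) * (y : ℝ))) (-(I * ω)) y := by
      have := (hasDerivAt_id y).ofReal_comp.const_mul (-(I * (ω : ℂ)))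
      simpa using this
    have h2 := (h1.cexp.mul_const (G ω))
    rw [mul_assoc] at h2
    exact h2

/-! ### The Riemann–Liouville integral as a Fourier integral. -/

/-- Boundedness of `v` handles `|ω| ≤ 1`, where `γ < 1` makes the singularity integrable; outside,
the power is at most `1`. -/
theorem integrable_rpow_neg_mul {v : ℝ → ℂ} (hv : Integrable v) {B : ℝ} (hB : ∀ ω, ‖v ω‖ ≤ B)
    {γ : ℝ} (h0 : 0 < γ) (h1 : γ < 1) : Integrable fun ω : ℝ => |ω| ^ (-γ) * ‖v ω‖ := by
  have hloc : IntegrableOn (fun ω : ℝ => |ω| ^ (-γ)) (Icc (-1) 1) := by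
    have h2 := (intervalIntegral.intervalIntegrable_cpow' (a := -1) (b := 1) (r := ((-γ : ℝ) : ℂ))
      (by simpa using h1)).norm
    rw [intervalIntegrable_iff_integrableOn_Icc_of_le (by norm_num)] at h2
    simpa only [norm_cpow_real, norm_real, Real.norm_eq_abs] using h2
  have hdom : Integrable fun ω : ℝ =>
      (Icc (-1) 1).indicator (fun ω : ℝ => |ω| ^ (-γ)) ω * B + ‖v ω‖ :=
    ((hloc.integrable_indicator measurableSet_Icc).mul_const B).add hv.norm
  refine hdom.mono' ?_ (Eventually.of_forall fun ω => ?_)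
  · exact (Measurable.aestronglyMeasurable (by fun_prop)).mul hv.norm.aestronglyMeasurable
  · rw [Real.norm_of_nonneg (by positivity)]
    by_cases h : ω ∈ Icc (-1 : ℝ) 1
    · rw [indicator_of_mem h]
      have := mul_le_mul_of_nonneg_left (hB ω) (Real.rpow_nonneg (abs_nonneg ω) (-γ))
      linarith [norm_nonneg (v ω)]
    · rw [indicator_of_notMem h, zero_mul, zero_add]
      refine mul_le_of_le_one_left (norm_nonneg _) ?_
      have h3 : 1 ≤ |ω| := by
        by_contra! h4
        exact h (abs_le.1 h4.le)
      exact Real.rpow_le_one_of_one_le_of_nonpos h3 (by linarith)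

theorem preimage_sub_Ioi (x : ℝ) : (fun ξ : ℝ => ξ - x) ⁻¹' Ioi 0 = Ioi x := by
  ext ξ
  simp

theorem setIntegral_Ioi_comp_sub {E : Type*} [NormedAddCommGroup E] [NormedSpace ℝ E]
    (F : ℝ → E) (x : ℝ) :
    ∫ ξ in Ioi x, F (ξ - x) = ∫ t in Ioi 0, F t := by
  have h := (measurePreserving_sub_right volume x).setIntegral_preimage_emb
    (MeasurableEquiv.subRight x).measurableEmbedding F (Ioi 0)
  rwa [preimage_sub_Ioi] at h

theorem integrableOn_Ioi_comp_sub {E : Type*} [NormedAddCommGroup E]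
    {F : ℝ → E} (x : ℝ) (hF : IntegrableOn F (Ioi 0)) :
    IntegrableOn (fun ξ => F (ξ - x)) (Ioi x) := by
  have h := ((measurePreserving_sub_right volume x).integrableOn_comp_preimage
    (MeasurableEquiv.subRight x).measurableEmbedding (f := F) (s := Ioi 0)).2 hF
  rwa [preimage_sub_Ioi] at h

theorem setIntegral_dampedKernel_mul_cexp {γ : ℝ} (hγ : 0 < γ) {ε : ℝ} (hε : 0 < ε) (x ω : ℝ) :
    ∫ ξ in Ioi x, (((ξ - x) ^ (γ - 1) * Real.exp (-ε * (ξ - x)) : ℝ) : ℂ) * cexp (-(I * ω * ξ)) =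
      cexp (-(I * ω * x)) * ((1 / (ε + I * ω)) ^ (γ : ℂ) * Complex.Gamma γ) := by
  rw [← integral_rpow_mul_cexp_neg_mul_Ioi hγ (r := ε + I * ω) (by simpa using hε),
    ← integral_const_mul, ← setIntegral_Ioi_comp_sub _ x]
  refine setIntegral_congr_fun measurableSet_Ioi fun ξ _ => ?_
  push_cast
  rw [mul_assoc, ← exp_add, mul_left_comm, ← exp_add]
  ring_nf

theorem integrableOn_dampedKernel {γ : ℝ} (hγ : 0 < γ) {ε : ℝ} (hε : 0 < ε) (x : ℝ) :
    IntegrableOn (fun ξ : ℝ => (ξ - x) ^ (γ - 1) * Real.exp (-ε * (ξ - x))) (Ioi x) := by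
  have h1 := integrableOn_rpow_mul_exp_neg_mul_rpow (p := 1) (s := γ - 1) (b := ε)
      (by linarith) one_pos hε
  simp only [Real.rpow_one] at h1
  exact integrableOn_Ioi_comp_sub x h1

theorem eq_conjFourierHat_fourierHat {u : ℝ → ℂ} (hu_cont : Continuous u) (hu : Integrable u)
    (hu_hat : Integrable (fourierHat u)) (x : ℝ) :
    u x = (2 * π : ℂ)⁻¹ * conjFourierHat (fourierHat u) x := by
  rw [conjFourierHat_fourierHat hu hu_hat hu_cont.continuousAt]
  have : (π : ℂ) ≠ 0 := by exact_mod_cast Real.pi_ne_zero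
  field_simp

/-- The damping `e^{-ε(ξ-x)}` makes the kernel integrable, so Fubini applies after inserting the
inversion formula for `u`; the inner integral is a Laplace transform at `ε + iω`. -/
theorem setIntegral_dampedKernel_mul {u : ℝ → ℂ} (hu_cont : Continuous u) (hu : Integrable u)
    (hu_hat : Integrable (fourierHat u)) {γ : ℝ} (hγ : 0 < γ) {ε : ℝ} (hε : 0 < ε) (x : ℝ) :
    ∫ ξ in Ioi x, (((ξ - x) ^ (γ - 1) * Real.exp (-ε * (ξ - x)) : ℝ) : ℂ) * u ξ =
      conjFourierHat (fun ω : ℝ => (1 / (ε + I * ω)) ^ (γ : ℂ) *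
        (Complex.Gamma γ / (2 * π) * fourierHat u ω)) x := by
  set k : ℝ → ℂ := fun ξ => (((ξ - x) ^ (γ - 1) * Real.exp (-ε * (ξ - x)) : ℝ) : ℂ) with hk
  have hki : IntegrableOn k (Ioi x) := (integrableOn_dampedKernel hγ hε x).ofReal
  have hprod : Integrable (fun p : ℝ × ℝ => cexp (-(I * p.2 * p.1)) * (k p.1 * fourierHat u p.2))
      ((volume.restrict (Ioi x)).prod volume) := by
    refine (hki.mul_prod hu_hat).bdd_mul (c := 1) (Continuous.aestronglyMeasurable (by fun_prop)) ?_
    exact Eventually.of_forall fun p => (norm_cexp_neg_I_mul p.2 p.1).le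
  have hswap := integral_integral_swap (f := fun ξ ω : ℝ =>
    cexp (-(I * ω * ξ)) * (k ξ * fourierHat u ω)) hprod
  calc ∫ ξ in Ioi x, k ξ * u ξ
      = ∫ ξ in Ioi x, (2 * π : ℂ)⁻¹ *
          ∫ ω : ℝ, cexp (-(I * (ω : ℝ) * (ξ : ℝ))) * (k ξ * fourierHat u ω) := by
        refine integral_congr_ae (Eventually.of_forall fun ξ => ?_)
        simp only
        rw [eq_conjFourierHat_fourierHat hu_cont hu hu_hat ξ, mul_left_comm, conjFourierHat,
          ← integral_const_mul]
        congr 1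
        refine integral_congr_ae (Eventually.of_forall fun ω => ?_)
        simp only
        ring
    _ = (2 * π : ℂ)⁻¹ * ∫ ω : ℝ, ∫ ξ in Ioi x,
          cexp (-(I * ω * ξ)) * (k ξ * fourierHat u ω) := by
        rw [integral_const_mul, hswap]
    _ = _ := by
        rw [conjFourierHat, ← integral_const_mul]
        refine integral_congr_ae (Eventually.of_forall fun ω => ?_)
        simp only
        have h := setIntegral_dampedKernel_mul_cexp hγ hε x ω
        have h2 : ∫ ξ in Ioi x, cexp (-(I * ω * ξ)) * (k ξ * fourierHat u ω) =
            (∫ ξ in Ioi x, k ξ * cexp (-(I * ω * ξ))) * fourierHat u ω := by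
          rw [← integral_mul_const]
          refine integral_congr_ae (Eventually.of_forall fun ξ => ?_)
          simp only
          ring
        rw [h2, h]
        ring

theorem norm_one_div_cpow_le {γ : ℝ} (hγ : 0 < γ) (ε : ℝ) {ω : ℝ} (h : ω ≠ 0) :
    ‖(1 / ((ε : ℂ) + I * ω)) ^ (γ : ℂ)‖ ≤ |ω| ^ (-γ) := by
  have hω : 0 < |ω| := abs_pos.2 h
  have h1 : |ω| ≤ ‖(ε : ℂ) + I * ω‖ := by
    simpa using abs_im_le_norm ((ε : ℂ) + I * ω)
  rw [norm_cpow_real, norm_div, norm_one, one_div, Real.inv_rpow (norm_nonneg _),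
    ← Real.rpow_neg (norm_nonneg _)]
  exact Real.rpow_le_rpow_of_nonpos hω h1 (by linarith)

theorem one_div_I_mul_mem_slitPlane {ω : ℝ} (hω : ω ≠ 0) : 1 / (I * (ω : ℂ)) ∈ slitPlane := by
  right
  rw [one_div, inv_im]
  simp [hω]

/-- The right Riemann–Liouville integral of `u` as an inverse Fourier integral. -/
theorem setIntegral_kernel_smul {u : ℝ → ℂ} (hu_cont : Continuous u) (hu : Integrable u)
    (hu_hat : Integrable (fourierHat u)) {γ : ℝ} (hγ : 0 < γ) (hγ1 : γ < 1) {x : ℝ}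
    (hk : IntegrableOn (fun ξ => (ξ - x) ^ (γ - 1) • u ξ) (Ioi x)) :
    ∫ ξ in Ioi x, (ξ - x) ^ (γ - 1) • u ξ =
      conjFourierHat (fun ω : ℝ => (1 / (I * ω)) ^ (γ : ℂ) *
        (Complex.Gamma γ / (2 * π) * fourierHat u ω)) x := by
  have hε : ∀ᶠ ε : ℝ in 𝓝[>] 0, 0 < ε := self_mem_nhdsWithin
  -- Let `ε → 0⁺` on both sides of the damped identity: the left is dominated by the absolutely
  -- convergent undamped integrand, the right by a multiple of `|ω|^{-γ} |û|`.
  have hlim1 : Tendsto (fun ε : ℝ => ∫ ξ in Ioi x,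
      (((ξ - x) ^ (γ - 1) * Real.exp (-ε * (ξ - x)) : ℝ) : ℂ) * u ξ) (𝓝[>] 0)
      (𝓝 (∫ ξ in Ioi x, (ξ - x) ^ (γ - 1) • u ξ)) := by
    refine tendsto_integral_filter_of_dominated_convergence
      (fun ξ => ‖(ξ - x) ^ (γ - 1) • u ξ‖) ?_ ?_ hk.norm ?_
    · exact Eventually.of_forall fun ε => (Measurable.aestronglyMeasurable (by fun_prop)).mul
        hu_cont.aestronglyMeasurable
    · filter_upwards [hε] with ε hε
      filter_upwards [ae_restrict_mem measurableSet_Ioi] with ξ hξ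
      have h1 : Real.exp (-ε * (ξ - x)) ≤ 1 := by
        rw [Real.exp_le_one_iff]
        have : 0 < ξ - x := sub_pos.2 hξ
        nlinarith
      rw [norm_mul, norm_smul, norm_real, norm_mul, Real.norm_of_nonneg (Real.exp_nonneg _)]
      exact mul_le_mul_of_nonneg_right (mul_le_of_le_one_right (norm_nonneg _) h1) (norm_nonneg _)
    · refine Eventually.of_forall fun ξ => ?_
      have : Continuous fun ε : ℝ =>
          (((ξ - x) ^ (γ - 1) * Real.exp (-ε * (ξ - x)) : ℝ) : ℂ) * u ξ := by fun_prop
      refine (this.tendsto' 0 _ ?_).mono_left nhdsWithin_le_nhds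
      simp
  have hv : Integrable fun ω => Complex.Gamma γ / (2 * π) * fourierHat u ω := hu_hat.const_mul _
  have hlim2 : Tendsto (fun ε : ℝ => conjFourierHat (fun ω : ℝ => (1 / (ε + I * ω)) ^ (γ : ℂ) *
        (Complex.Gamma γ / (2 * π) * fourierHat u ω)) x) (𝓝[>] 0)
      (𝓝 (conjFourierHat (fun ω : ℝ => (1 / (I * ω)) ^ (γ : ℂ) *
        (Complex.Gamma γ / (2 * π) * fourierHat u ω)) x)) := by
    refine tendsto_integral_filter_of_dominated_convergence
      (fun ω => |ω| ^ (-γ) * ‖Complex.Gamma γ / (2 * π) * fourierHat u ω‖) ?_ ?_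
      (integrable_rpow_neg_mul hv (B := ‖Complex.Gamma γ / (2 * π)‖ * ∫ x, ‖u x‖) ?_ hγ hγ1) ?_
    · exact Eventually.of_forall fun ε => (Measurable.aestronglyMeasurable (by fun_prop)).mul
        ((Measurable.aestronglyMeasurable (by fun_prop)).mul hv.aestronglyMeasurable)
    · refine Eventually.of_forall fun ε => ?_
      filter_upwards [compl_mem_ae_iff.2 (measure_singleton (0 : ℝ))] with ω hω
      rw [norm_mul, norm_cexp_neg_I_mul, one_mul, norm_mul]
      exact mul_le_mul_of_nonneg_right (norm_one_div_cpow_le hγ ε hω) (norm_nonneg _)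
    · intro ω
      rw [norm_mul]
      exact mul_le_mul_of_nonneg_left (norm_fourierHat_le u ω) (norm_nonneg _)
    · filter_upwards [compl_mem_ae_iff.2 (measure_singleton (0 : ℝ))] with ω hω
      have hω' : ω ≠ 0 := hω
      have h1 : ContinuousAt (fun ε : ℝ => 1 / ((ε : ℂ) + I * ω)) 0 := by
        refine ContinuousAt.div (by fun_prop) (by fun_prop) ?_
        simpa using hω'
      have h2 : Tendsto (fun ε : ℝ => 1 / ((ε : ℂ) + I * ω)) (𝓝[>] 0) (𝓝 (1 / (I * ω))) := by
        have := h1.tendsto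
        simp only [ofReal_zero, zero_add] at this
        exact this.mono_left nhdsWithin_le_nhds
      have h3 := (continuousAt_cpow_const (b := (γ : ℂ))
        (one_div_I_mul_mem_slitPlane hω')).tendsto.comp h2
      exact (h3.mul_const _).const_mul _
  refine tendsto_nhds_unique hlim1 (hlim2.congr' ?_)
  filter_upwards [hε] with ε hε
  exact (setIntegral_dampedKernel_mul hu_cont hu hu_hat hγ hε x).symm

/-! ### Recovering the transform of a pointwise derivative through finite differences. -/

/-- The moving average of `f` over intervals of unit length. -/
noncomputable def unitAvg (f : ℝ → ℂ) (x : ℝ) : ℂ := ∫ t in (0 : ℝ)..1, f (x + t)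

theorem unitAvg_eq_fwdDiff {g g' : ℝ → ℂ} (h : ∀ x, HasDerivAt g (g' x) x)
    (hg' : LocallyIntegrable g') : unitAvg g' = fwdDiff 1 g := by
  funext x
  rw [unitAvg, intervalIntegral.integral_comp_add_left g' x, add_zero, fwdDiff]
  exact intervalIntegral.integral_eq_sub_of_hasDerivAt (fun y _ => h y)
    (hg'.integrableOn_isCompact isCompact_uIcc).intervalIntegrable

theorem hasDerivAt_fwdDiff_iterate {f f' : ℝ → ℂ} (h : ∀ x, HasDerivAt f (f' x) x) (n : ℕ) :
    ∀ x, HasDerivAt ((fwdDiff 1)^[n] f) ((fwdDiff 1)^[n] f' x) x := by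
  induction n with
  | zero => simpa using h
  | succ n ih =>
    intro x
    rw [Function.iterate_succ_apply', Function.iterate_succ_apply']
    exact ((ih (x + 1)).comp_add_const x 1).sub (ih x)

theorem locallyIntegrable_fwdDiff_iterate {f : ℝ → ℂ} (h : LocallyIntegrable f) (n : ℕ) :
    LocallyIntegrable ((fwdDiff (1 : ℝ))^[n] f) := by
  induction n with
  | zero => simpa using h
  | succ n ih =>
    rw [Function.iterate_succ_apply']
    refine LocallyIntegrable.sub ?_ ih
    rw [locallyIntegrable_iff]
    intro K hK
    have h1 := (measurePreserving_add_right volume (1 : ℝ)).integrableOn_image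
      (MeasurableEquiv.addRight (1 : ℝ)).measurableEmbedding
      (f := (fwdDiff (1 : ℝ))^[n] f) (s := K)
    exact h1.1 (ih.integrableOn_isCompact (hK.image (by fun_prop)))

/-- A unit difference is the average of the derivative over a unit interval, and differences commute
with derivatives. The fundamental theorem is used for an everywhere existing, locally integrable
derivative; the top one need not be continuous. -/
theorem fwdDiff_iterate_eq_unitAvg_iterate (n : ℕ) {f : ℝ → ℂ}
    (hf : ∀ k < n, Differentiable ℝ (iteratedDeriv k f))
    (hn : LocallyIntegrable (iteratedDeriv n f)) :
    (fwdDiff (1 : ℝ))^[n] f = unitAvg^[n] (iteratedDeriv n f) := by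
  induction n generalizing f with
  | zero => simp
  | succ n ih =>
    have hf' : ∀ k < n, Differentiable ℝ (iteratedDeriv k (deriv f)) := fun k hk => by
      rw [← iteratedDeriv_succ']
      exact hf (k + 1) (by omega)
    have hd : ∀ x, HasDerivAt f (deriv f x) x := fun x => by
      have := hf 0 (by omega)
      rw [iteratedDeriv_zero] at this
      exact (this x).hasDerivAt
    have hloc : LocallyIntegrable (deriv f) := by
      rcases n with _ | n
      · simpa using hn
      · have := hf' 0 (by omega)
        rw [iteratedDeriv_zero] at this
        exact this.continuous.locallyIntegrable
    rw [iteratedDeriv_succ'] at hn ⊢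
    rw [Function.iterate_succ_apply', Function.iterate_succ_apply', ← ih hf' hn,
      unitAvg_eq_fwdDiff (hasDerivAt_fwdDiff_iterate hd n)
        (locallyIntegrable_fwdDiff_iterate hloc n)]

theorem integrable_comp_add_prod {g : ℝ → ℂ} (hg : Integrable g) :
    Integrable (fun p : ℝ × ℝ => g (p.1 + p.2)) (volume.prod (volume.restrict (Ioc 0 1))) := by
  have hm : AEStronglyMeasurable (fun p : ℝ × ℝ => g (p.1 + p.2))
      (volume.prod (volume.restrict (Ioc 0 1))) := by
    have h1 : AEStronglyMeasurable (fun p : ℝ × ℝ => g (p.1 + p.2)) (volume.prod volume) :=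
      hg.aestronglyMeasurable.comp_quasiMeasurePreserving (quasiMeasurePreserving_add _ _)
    exact h1.mono_ac (Measure.AbsolutelyContinuous.rfl.prod
      Measure.restrict_le_self.absolutelyContinuous)
  rw [integrable_prod_iff' hm]
  refine ⟨Eventually.of_forall fun t => hg.comp_add_right t, ?_⟩
  simp only [integral_add_right_eq_self (fun x => ‖g x‖)]
  exact integrable_const _

theorem unitAvg_eq_setIntegral (g : ℝ → ℂ) (x : ℝ) : unitAvg g x = ∫ t in Ioc 0 1, g (x + t) :=
  intervalIntegral.integral_of_le zero_le_one

theorem integrable_unitAvg {g : ℝ → ℂ} (hg : Integrable g) : Integrable (unitAvg g) := by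
  have := (integrable_comp_add_prod hg).integral_prod_left
  simpa only [← unitAvg_eq_setIntegral] using this

theorem fourierHat_comp_add (g : ℝ → ℂ) (t ω : ℝ) :
    fourierHat (fun x => g (x + t)) ω = cexp (-(I * ω * t)) * fourierHat g ω := by
  rw [fourierHat, fourierHat, ← integral_const_mul,
    ← integral_add_right_eq_self (fun x : ℝ => cexp (-(I * ω * t)) * (cexp (I * ω * x) * g x)) t]
  refine integral_congr_ae (Eventually.of_forall fun x => ?_)
  simp only
  rw [← mul_assoc, ← exp_add]
  congr 2
  push_cast
  ring

theorem fourierHat_unitAvg {g : ℝ → ℂ} (hg : Integrable g) (ω : ℝ) :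
    fourierHat (unitAvg g) ω = (∫ t in (0 : ℝ)..1, cexp (-(I * ω * t))) * fourierHat g ω := by
  have hprod : Integrable (fun p : ℝ × ℝ => cexp (I * ω * p.1) * g (p.1 + p.2))
      (volume.prod (volume.restrict (Ioc 0 1))) := by
    refine (integrable_comp_add_prod hg).bdd_mul (c := 1)
      (Continuous.aestronglyMeasurable (by fun_prop)) ?_
    exact Eventually.of_forall fun p => (norm_cexp_I_mul ω p.1).le
  have hswap := integral_integral_swap (f := fun x t : ℝ => cexp (I * ω * x) * g (x + t)) hprod
  rw [intervalIntegral.integral_of_le zero_le_one, ← integral_mul_const, fourierHat]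
  simp only [unitAvg_eq_setIntegral, ← integral_const_mul]
  rw [hswap]
  refine integral_congr_ae (Eventually.of_forall fun t => ?_)
  exact fourierHat_comp_add g t ω

theorem unitAvg_iterate {g : ℝ → ℂ} (hg : Integrable g) (n : ℕ) :
    Integrable (unitAvg^[n] g) ∧ ∀ ω : ℝ, fourierHat (unitAvg^[n] g) ω =
      (∫ t in (0 : ℝ)..1, cexp (-(I * ω * t))) ^ n * fourierHat g ω := by
  induction n with
  | zero => simpa using hg
  | succ n ih =>
    rw [Function.iterate_succ_apply']
    refine ⟨integrable_unitAvg ih.1, fun ω => ?_⟩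
    rw [fourierHat_unitAvg ih.1, ih.2]
    ring

theorem integrable_cexp_sub_one_pow_mul {G : ℝ → ℂ} (hG : Integrable G) (n : ℕ) :
    Integrable fun ω : ℝ => (cexp (-(I * ω)) - 1) ^ n * G ω := by
  refine hG.bdd_mul (c := 2 ^ n) (Continuous.aestronglyMeasurable (by fun_prop)) ?_
  refine Eventually.of_forall fun ω => ?_
  rw [norm_pow]
  gcongr
  refine (norm_sub_le _ _).trans ?_
  have := norm_cexp_neg_I_mul ω 1
  rw [ofReal_one, mul_one] at this
  rw [this]
  norm_num

theorem fwdDiff_iterate_conjFourierHat {G : ℝ → ℂ} (hG : Integrable G) (n : ℕ) :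
    (fwdDiff (1 : ℝ))^[n] (conjFourierHat G) =
      conjFourierHat fun ω : ℝ => (cexp (-(I * ω)) - 1) ^ n * G ω := by
  induction n with
  | zero => simp
  | succ n ih =>
    have hi := integrable_cexp_sub_one_pow_mul hG n
    rw [Function.iterate_succ_apply', ih]
    funext x
    rw [fwdDiff, conjFourierHat, conjFourierHat, ← integral_sub (integrable_cexp_mul hi _)
      (integrable_cexp_mul hi _)]
    refine integral_congr_ae (Eventually.of_forall fun ω => ?_)
    simp only
    have : cexp (-(I * ω * ((x + 1 : ℝ) : ℂ))) = cexp (-(I * ω * x)) * cexp (-(I * ω)) := by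
      rw [← exp_add]
      push_cast
      ring_nf
    rw [this]
    ring

theorem neg_I_mul_integral_cexp (ω : ℝ) :
    -(I * ω) * ∫ t in (0 : ℝ)..1, cexp (-(I * ω * t)) = cexp (-(I * ω)) - 1 := by
  rcases eq_or_ne ω 0 with rfl | h
  · simp
  have hc : -(I * (ω : ℂ)) ≠ 0 := by simpa using h
  have := integral_exp_mul_complex (a := 0) (b := 1) hc
  simp only [neg_mul] at this
  simp only [this]
  have hω : (ω : ℂ) ≠ 0 := by exact_mod_cast h
  field_simp
  simp

theorem ae_cexp_neg_ne_one {h : ℝ} (hh : h ≠ 0) : ∀ᵐ ω : ℝ, cexp (-(I * ω * h)) ≠ 1 := by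
  have hcount : {ω : ℝ | cexp (-(I * ω * h)) = 1}.Countable := by
    refine (countable_range fun k : ℤ => -(k * (2 * π) : ℝ) / h).mono ?_
    intro ω hω
    obtain ⟨k, hk⟩ := Complex.exp_eq_one_iff.1 hω
    refine ⟨k, ?_⟩
    have := congrArg Complex.im hk
    simp at this
    simp only
    rw [div_eq_iff hh]
    linarith
  exact compl_mem_ae_iff.2 (hcount.measure_zero volume)

/-- If `I = ∫ e^{-iωx} G(ω) dω` has an integrable `n`-th derivative `w`, then
`2π (-iω)^n G(ω) = ŵ(ω)` for almost all `ω`. -/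
theorem ae_pow_mul_eq_fourierHat_iteratedDeriv {G : ℝ → ℂ} (hG : Integrable G)
    (hGc : ∀ ω, ω ≠ 0 → ContinuousAt G ω) (n : ℕ)
    (hf : ∀ k < n, Differentiable ℝ (iteratedDeriv k (conjFourierHat G)))
    (hn : Integrable (iteratedDeriv n (conjFourierHat G))) :
    ∀ᵐ ω : ℝ, 2 * π * ((-(I * ω)) ^ n * G ω) =
      fourierHat (iteratedDeriv n (conjFourierHat G)) ω := by
  -- Outside `2πℤ`, both `ω` and the multiplier `m(ω) = ∫₀¹ e^{-iωt} dt` of the moving average are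
  -- nonzero; `m(ω)^n` is cancelled using `-iω m(ω) = e^{-iω} - 1`.
  filter_upwards [ae_cexp_neg_ne_one one_ne_zero] with ω hω
  rw [ofReal_one, mul_one] at hω
  have hω1 : cexp (-(I * ω)) - 1 ≠ 0 := sub_ne_zero.2 hω
  have hω0 : ω ≠ 0 := by
    rintro rfl
    simp at hω1
  have h1 := fwdDiff_iterate_eq_unitAvg_iterate n hf hn.locallyIntegrable
  rw [fwdDiff_iterate_conjFourierHat hG] at h1
  obtain ⟨h2, h3⟩ := unitAvg_iterate hn n
  have h4 := fourierHat_conjFourierHat (integrable_cexp_sub_one_pow_mul hG n)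
    (by rw [h1]; exact h2) (ω := ω)
    (ContinuousAt.mul (by fun_prop) (hGc ω hω0))
  rw [h1, h3] at h4
  rw [← neg_I_mul_integral_cexp] at h4 hω1
  have hm := pow_ne_zero n (right_ne_zero_of_mul hω1)
  apply mul_left_cancel₀ hm
  rw [h4]
  ring

/-! ### The derivative of order `α` as a Fourier multiplier. -/

theorem rlOrder_of_mem {α : ℝ} (h1 : 1 < α) (h2 : α < 2) : rlOrder α = 2 := by
  have : ⌊α⌋₊ = 1 := (Nat.floor_eq_iff (by linarith)).2 ⟨by exact_mod_cast h1.le,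
    by norm_num; exact h2⟩
  rw [rlOrder, this]

theorem rlOrder_add_four {α : ℝ} (h1 : 1 < α) (h2 : α < 2) : rlOrder (α + 4) = 6 := by
  have : ⌊α + 4⌋₊ = 5 := (Nat.floor_eq_iff (by linarith)).2 ⟨by norm_num; linarith,
    by norm_num; linarith⟩
  rw [rlOrder, this]

theorem kernelExponent {α : ℝ} (h1 : 1 < α) (h2 : α < 2) :
    (rlOrder α : ℝ) - α - 1 = 2 - α - 1 := by
  rw [rlOrder_of_mem h1 h2]
  norm_num

theorem kernelExponent_add_four {α : ℝ} (h1 : 1 < α) (h2 : α < 2) :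
    (rlOrder (α + 4) : ℝ) - (α + 4) - 1 = 2 - α - 1 := by
  rw [rlOrder_add_four h1 h2]
  norm_num
  ring

theorem rightRLKernelIntegral_add_four {α : ℝ} (h1 : 1 < α) (h2 : α < 2) (u : ℝ → ℂ) :
    rightRLKernelIntegral (α + 4) u = rightRLKernelIntegral α u := by
  funext x
  rw [rightRLKernelIntegral, rightRLKernelIntegral, kernelExponent h1 h2,
    kernelExponent_add_four h1 h2]

theorem RightRLExists.of_add_four {α : ℝ} (h1 : 1 < α) (h2 : α < 2) {u : ℝ → ℂ}
    (h : RightRLExists (α + 4) u) : RightRLExists α u := by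
  obtain ⟨ha, hb⟩ := h
  rw [rightRLKernelIntegral_add_four h1 h2, rlOrder_add_four h1 h2] at hb
  rw [kernelExponent_add_four h1 h2] at ha
  refine ⟨by rwa [kernelExponent h1 h2], fun k hk => hb k ?_⟩
  rw [rlOrder_of_mem h1 h2] at hk
  omega

/-- The density of which the Riemann–Liouville integral of order `γ` of `u` is the Fourier
integral. -/
noncomputable def kernelDensity (γ : ℝ) (u : ℝ → ℂ) (ω : ℝ) : ℂ :=
  (1 / (I * ω)) ^ (γ : ℂ) * (Complex.Gamma γ / (2 * π) * fourierHat u ω)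

theorem norm_one_div_I_mul_cpow (γ ω : ℝ) : ‖(1 / (I * (ω : ℂ))) ^ (γ : ℂ)‖ = |ω| ^ (-γ) := by
  rw [norm_cpow_real, norm_div, norm_one, norm_mul, norm_I, one_mul, norm_real, one_div,
    Real.norm_eq_abs, Real.inv_rpow (abs_nonneg _), Real.rpow_neg (abs_nonneg _)]

theorem integrable_kernelDensity {γ : ℝ} (h0 : 0 < γ) (h1 : γ < 1) {u : ℝ → ℂ}
    (hu_hat : Integrable (fourierHat u)) : Integrable (kernelDensity γ u) := by
  have hv : Integrable fun ω => Complex.Gamma γ / (2 * π) * fourierHat u ω := hu_hat.const_mul _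
  refine (integrable_rpow_neg_mul hv (B := ‖Complex.Gamma γ / (2 * π)‖ * ∫ x, ‖u x‖) ?_ h0
    h1).mono' ((Measurable.aestronglyMeasurable (by fun_prop)).mul hv.aestronglyMeasurable)
    (Eventually.of_forall fun ω => ?_)
  · intro ω
    rw [norm_mul]
    exact mul_le_mul_of_nonneg_left (norm_fourierHat_le u ω) (norm_nonneg _)
  · rw [kernelDensity, norm_mul, norm_one_div_I_mul_cpow]

theorem continuousAt_kernelDensity (γ : ℝ) {u : ℝ → ℂ} (hu : Integrable u) {ω : ℝ} (hω : ω ≠ 0) :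
    ContinuousAt (kernelDensity γ u) ω := by
  have h1 : ContinuousAt (fun ω : ℝ => 1 / (I * (ω : ℂ))) ω := by
    refine ContinuousAt.div (by fun_prop) (by fun_prop) ?_
    simpa using hω
  refine ContinuousAt.mul ?_ (continuousAt_const.mul (continuous_fourierHat hu).continuousAt)
  exact h1.cpow continuousAt_const (one_div_I_mul_mem_slitPlane hω)

theorem fourierHat_smul (c : ℝ) (f : ℝ → ℂ) (ω : ℝ) :
    fourierHat (fun x => c • f x) ω = c • fourierHat f ω := by
  simp only [fourierHat, mul_smul_comm, integral_smul]

section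

variable {α : ℝ} {u : ℝ → ℂ}

theorem rightRLKernelIntegral_eq (h1 : 1 < α) (h2 : α < 2) (hu_cont : Continuous u)
    (hu : Integrable u) (hu_hat : Integrable (fourierHat u)) (hex : RightRLExists α u) :
    rightRLKernelIntegral α u = conjFourierHat (kernelDensity (2 - α) u) := by
  funext x
  have h3 := hex.1 x
  rw [rightRLKernelIntegral]
  rw [kernelExponent h1 h2] at h3 ⊢
  exact setIntegral_kernel_smul hu_cont hu hu_hat (by linarith) (by linarith) h3

theorem integrable_pow_six_mul_kernelDensity (h1 : 1 < α) (h2 : α < 2) (hu_cont : Continuous u)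
    (hu : Integrable u) (hu_hat : Integrable (fourierHat u)) (hex : RightRLExists (α + 4) u)
    (hD : Integrable (rightRL (α + 4) u)) (hD_hat : Integrable (fourierHat (rightRL (α + 4) u))) :
    Integrable fun ω : ℝ => (-(I * ω)) ^ 6 * kernelDensity (2 - α) u ω := by
  have hI := rightRLKernelIntegral_eq h1 h2 hu_cont hu hu_hat (hex.of_add_four h1 h2)
  have hΓ : Real.Gamma (2 - α) ≠ 0 := (Real.Gamma_pos_of_pos (by linarith)).ne'
  have hw : iteratedDeriv 6 (conjFourierHat (kernelDensity (2 - α) u)) =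
      fun x => Real.Gamma (2 - α) • rightRL (α + 4) u x := by
    funext x
    have hsub : ((6 : ℕ) : ℝ) - (α + 4) = 2 - α := by norm_num; ring
    rw [rightRL, rlOrder_add_four h1 h2, rightRLKernelIntegral_add_four h1 h2, hI, smul_smul, hsub,
      mul_div_cancel₀ _ hΓ]
    norm_num
  have hdiff := hex.2
  rw [rightRLKernelIntegral_add_four h1 h2, rlOrder_add_four h1 h2, hI] at hdiff
  have hae := ae_pow_mul_eq_fourierHat_iteratedDeriv
    (integrable_kernelDensity (by linarith) (by linarith) hu_hat)
    (fun ω hω => continuousAt_kernelDensity (2 - α) hu hω) 6 hdiff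
    (by rw [hw]; exact hD.smul (Real.Gamma (2 - α)))
  rw [hw] at hae
  refine ((hD_hat.smul (Real.Gamma (2 - α))).const_mul ((2 * π : ℂ)⁻¹)).congr ?_
  filter_upwards [hae] with ω hω
  rw [fourierHat_smul] at hω
  simp only [Pi.smul_apply]
  rw [← hω, inv_mul_cancel_left₀]
  exact_mod_cast (by positivity : (2 * π : ℝ) ≠ 0)

/-- The density carries `|ω|^{-(2-α)}`, and `6 - (2 - α) = α + 4`. -/
theorem integrable_abs_rpow_mul_fourierHat (h2 : α < 2)
    (h6 : Integrable fun ω : ℝ => (-(I * ω)) ^ 6 * kernelDensity (2 - α) u ω) :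
    Integrable fun ω : ℝ => |ω| ^ (α + 4) * ‖fourierHat u ω‖ := by
  have hΓ : Real.Gamma (2 - α) ≠ 0 := (Real.Gamma_pos_of_pos (by linarith)).ne'
  set c : ℂ := Complex.Gamma (2 - α : ℝ) / (2 * π) with hc
  have hc0 : c ≠ 0 := by
    rw [hc, Complex.Gamma_ofReal]
    refine div_ne_zero (by exact_mod_cast hΓ) (by exact_mod_cast (by positivity : (2 * π : ℝ) ≠ 0))
  refine (h6.norm.const_mul ‖c‖⁻¹).congr ?_
  filter_upwards [compl_mem_ae_iff.2 (measure_singleton (0 : ℝ))] with ω hω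
  have hω' : 0 < |ω| := abs_pos.2 hω
  rw [kernelDensity, norm_mul, norm_mul, norm_one_div_I_mul_cpow, ← hc, norm_mul, norm_pow,
    norm_neg, norm_mul, norm_I, one_mul, norm_real, Real.norm_eq_abs,
    show α + 4 = ((6 : ℕ) : ℝ) + -(2 - α) by norm_num; ring, Real.rpow_add hω', Real.rpow_natCast]
  have := norm_ne_zero_iff.2 hc0
  field_simp

theorem integrable_pow_mul_of_le {G : ℝ → ℂ} (hG : Integrable G) {n : ℕ}
    (hn : Integrable fun ω : ℝ => (-(I * ω)) ^ n * G ω) {k : ℕ} (hk : k ≤ n) :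
    Integrable fun ω : ℝ => (-(I * ω)) ^ k * G ω := by
  refine (hG.norm.add hn.norm).mono' ((Continuous.aestronglyMeasurable (by fun_prop)).mul
    hG.aestronglyMeasurable) (Eventually.of_forall fun ω => ?_)
  simp only [norm_mul, norm_pow, norm_neg, norm_I, one_mul, norm_real, Real.norm_eq_abs,
    Pi.add_apply]
  rcases le_total |ω| 1 with h | h
  · have := mul_le_mul_of_nonneg_right (pow_le_one₀ (n := k) (abs_nonneg ω) h) (norm_nonneg (G ω))
    have h3 : 0 ≤ |ω| ^ n * ‖G ω‖ := by positivity
    linarith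
  · have := mul_le_mul_of_nonneg_right (pow_le_pow_right₀ h hk) (norm_nonneg (G ω))
    linarith [norm_nonneg (G ω)]

theorem integrable_cpow_mul_fourierHat (h0 : 0 ≤ α) (hu_hat : Integrable (fourierHat u))
    (hi : Integrable fun ω : ℝ => |ω| ^ (α + 4) * ‖fourierHat u ω‖) :
    Integrable fun ω : ℝ => (I * ω) ^ (α : ℂ) * fourierHat u ω := by
  refine (hu_hat.norm.add hi).mono' ((Measurable.aestronglyMeasurable (by fun_prop)).mul
    hu_hat.aestronglyMeasurable) (Eventually.of_forall fun ω => ?_)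
  simp only [norm_mul, norm_cpow_real, norm_I, one_mul, norm_real, Real.norm_eq_abs, Pi.add_apply]
  rcases le_total |ω| 1 with h | h
  · have := mul_le_mul_of_nonneg_right (Real.rpow_le_one (abs_nonneg ω) h h0)
      (norm_nonneg (fourierHat u ω))
    have h3 : 0 ≤ |ω| ^ (α + 4) * ‖fourierHat u ω‖ := by positivity
    linarith
  · have := mul_le_mul_of_nonneg_right
      (Real.rpow_le_rpow_of_exponent_le h (by linarith : α ≤ α + 4)) (norm_nonneg (fourierHat u ω))
    linarith [norm_nonneg (fourierHat u ω)]

theorem sq_mul_one_div_cpow {z : ℂ} (hz : z ∈ slitPlane) (a : ℂ) :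
    z ^ 2 * (1 / z) ^ (2 - a) = z ^ a := by
  have hz0 := slitPlane_ne_zero hz
  rw [one_div, inv_cpow _ _ (slitPlane_arg_ne_pi hz), ← cpow_neg, ← cpow_two, ← cpow_add _ _ hz0]
  ring_nf

theorem I_mul_mem_slitPlane {ω : ℝ} (hω : ω ≠ 0) : I * (ω : ℂ) ∈ slitPlane := by
  right
  simpa using hω

theorem rightRL_eq_conjFourierHat (h1 : 1 < α) (h2 : α < 2) (hu_cont : Continuous u)
    (hu : Integrable u) (hu_hat : Integrable (fourierHat u)) (hex : RightRLExists α u)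
    (h6 : Integrable fun ω : ℝ => (-(I * ω)) ^ 6 * kernelDensity (2 - α) u ω) (x : ℝ) :
    rightRL α u x =
      (2 * π : ℂ)⁻¹ * conjFourierHat (fun ω : ℝ => (I * ω) ^ (α : ℂ) * fourierHat u ω) x := by
  have hG : Integrable (kernelDensity (2 - α) u) :=
    integrable_kernelDensity (by linarith) (by linarith) hu_hat
  have hi1 : Integrable fun ω : ℝ => -(I * ω) * kernelDensity (2 - α) u ω := by
    simpa only [pow_one] using integrable_pow_mul_of_le hG h6 (k := 1) (by norm_num)
  have hi2 : Integrable fun ω : ℝ => -(I * ω) * (-(I * ω) * kernelDensity (2 - α) u ω) := by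
    simpa only [pow_two, mul_assoc] using integrable_pow_mul_of_le hG h6 (k := 2) (by norm_num)
  -- Integrability of the density and of its sixth moment controls the first and second moments, so
  -- differentiation under the integral is legitimate twice.
  have hd : iteratedDeriv 2 (conjFourierHat (kernelDensity (2 - α) u)) =
      conjFourierHat fun ω : ℝ => -(I * ω) * (-(I * ω) * kernelDensity (2 - α) u ω) := by
    rw [iteratedDeriv_succ, iteratedDeriv_one,
      funext fun y => (hasDerivAt_conjFourierHat hG hi1 y).deriv]
    exact funext fun y => (hasDerivAt_conjFourierHat hi1 hi2 y).deriv
  have hΓ : Real.Gamma (2 - α) ≠ 0 := (Real.Gamma_pos_of_pos (by linarith)).ne'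
  rw [rightRL, rightRLKernelIntegral_eq h1 h2 hu_cont hu hu_hat hex, rlOrder_of_mem h1 h2, hd,
    conjFourierHat, conjFourierHat, ← integral_const_mul, ← integral_smul]
  refine integral_congr_ae ?_
  filter_upwards [compl_mem_ae_iff.2 (measure_singleton (0 : ℝ))] with ω hω
  rw [← sq_mul_one_div_cpow (I_mul_mem_slitPlane hω), kernelDensity, Complex.Gamma_ofReal,
    real_smul]
  have hΓ' : (Real.Gamma (2 - α) : ℂ) ≠ 0 := by exact_mod_cast hΓ
  push_cast
  field_simp

/-! ### The difference operators as Fourier multipliers, and the error estimate. -/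

theorem norm_le_of_fourierHat (hu_cont : Continuous u) (hu : Integrable u)
    (hu_hat : Integrable (fourierHat u)) (x : ℝ) :
    ‖u x‖ ≤ ‖(2 * π : ℂ)⁻¹‖ * ∫ ω, ‖fourierHat u ω‖ := by
  rw [eq_conjFourierHat_fourierHat hu_cont hu hu_hat x, norm_mul]
  exact mul_le_mul_of_nonneg_left (norm_conjFourierHat_le _ x) (norm_nonneg _)

theorem summable_qCoeff_smul (h1 : 1 ≤ α) (h2 : α ≤ 2) {B : ℝ} (hB : ∀ x, ‖u x‖ ≤ B) (y : ℕ → ℝ) :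
    Summable fun k : ℕ => qCoeff α k • u (y k) := by
  refine Summable.of_norm_bounded ((summable_abs_qCoeff h1 h2).mul_right B) fun k => ?_
  rw [norm_smul]
  exact mul_le_mul_of_nonneg_left (hB _) (norm_nonneg _)

theorem measurable_shiftSymbol (α : ℝ) (j : ℤ) : Measurable (shiftSymbol α j) := by
  unfold shiftSymbol qSymbol
  fun_prop

theorem rightA_eq_conjFourierHat (h1 : 1 < α) (h2 : α < 2) (hu_cont : Continuous u)
    (hu : Integrable u) (hu_hat : Integrable (fourierHat u)) {h : ℝ} (hh : 0 < h) (j : ℤ) (x : ℝ) :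
    rightA α h j u x = (2 * π : ℂ)⁻¹ * conjFourierHat
      (fun ω : ℝ => ((1 / h ^ α : ℝ) : ℂ) * shiftSymbol α j (ω * h) * fourierHat u ω) x := by
  set y : ℕ → ℝ := fun k => x + ((k : ℝ) - (j : ℝ)) * h with hy
  set F : ℕ → ℝ → ℂ := fun k ω =>
    qCoeff α k * (cexp (-(I * ω * y k)) * fourierHat u ω) with hF
  have hFi : ∀ k, Integrable (F k) := fun k => (integrable_cexp_mul hu_hat (y k)).const_mul _
  have hFs : Summable fun k => ∫ ω, ‖F k ω‖ := by
    simp only [hF, norm_mul, norm_cexp_neg_I_mul, one_mul, integral_const_mul, norm_real]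
    exact (summable_abs_qCoeff h1.le h2.le).mul_right _
  have hsum := (hasSum_integral_of_summable_integral_norm hFi hFs).tsum_eq
  have hterm : ∀ k, qCoeff α k • u (y k) = (2 * π : ℂ)⁻¹ * ∫ ω, F k ω := by
    intro k
    rw [eq_conjFourierHat_fourierHat hu_cont hu hu_hat (y k), real_smul, integral_const_mul,
      conjFourierHat]
    ring
  rw [rightA, tsum_congr hterm, tsum_mul_left, hsum, real_smul, conjFourierHat, mul_left_comm,
    ← integral_const_mul]
  congr 1
  refine integral_congr_ae ?_
  -- The generating function is summed at `ζ = e^{-iωh}`; the frequencies with `ζ = 1`, not covered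
  -- there, form a null set.
  filter_upwards [ae_cexp_neg_ne_one hh.ne'] with ω hω
  have hq := hasSum_qCoeff h1.le h2.le (ζ := cexp (-(I * ω * h))) (norm_cexp_neg_I_mul ω h).le hω
  have hexp : ∀ k : ℕ, cexp (-(I * ω * y k)) =
      cexp (-(I * ω * x)) * cexp (I * j * (ω * h)) * cexp (-(I * ω * h)) ^ k := by
    intro k
    rw [← exp_nat_mul, ← exp_add, ← exp_add]
    congr 1
    simp only [hy]
    push_cast
    ring
  have hFk : ∀ k, F k ω = cexp (-(I * ω * x)) * cexp (I * j * (ω * h)) * fourierHat u ω *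
      (qCoeff α k * cexp (-(I * ω * h)) ^ k) := by
    intro k
    simp only [hF, hexp]
    ring
  rw [tsum_congr hFk, tsum_mul_left, hq.tsum_eq, shiftSymbol]
  push_cast
  rw [← mul_assoc I (ω : ℂ) h]
  ring

theorem linearCombination_conjFourierHat (c : ℤ →₀ ℂ) {F : ℤ → ℝ → ℂ} (hF : ∀ j, Integrable (F j))
    (x : ℝ) : Finsupp.linearCombination ℂ (fun j => conjFourierHat (F j) x) c =
      conjFourierHat (fun ω => Finsupp.linearCombination ℂ (fun j => F j ω) c) x := by
  simp only [Finsupp.linearCombination_apply, Finsupp.sum, conjFourierHat, smul_eq_mul,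
    Finset.mul_sum]
  rw [integral_finsetSum]
  · refine Finset.sum_congr rfl fun j _ => ?_
    rw [← integral_const_mul]
    refine integral_congr_ae (Eventually.of_forall fun ω => ?_)
    simp only
    ring
  · intro j _
    have := (integrable_cexp_mul (hF j) x).const_mul (c j)
    refine this.congr (Eventually.of_forall fun ω => ?_)
    simp only
    ring

theorem integrable_shiftSymbol_mul (h0 : 0 ≤ α) (hu_hat : Integrable (fourierHat u)) (a : ℂ)
    (h : ℝ) (j : ℤ) :
    Integrable fun ω : ℝ => a * shiftSymbol α j (ω * h) * fourierHat u ω := by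
  have hm : Measurable fun ω : ℝ => shiftSymbol α j (ω * h) :=
    (measurable_shiftSymbol α j).comp (by fun_prop)
  refine hu_hat.bdd_mul (c := ‖a‖ * ((3 / 2 : ℝ) ^ α * (2 ^ α * 2 ^ α)))
    (hm.const_mul a).aestronglyMeasurable (Eventually.of_forall fun ω => ?_)
  rw [norm_mul]
  exact mul_le_mul_of_nonneg_left (norm_shiftSymbol_le h0 j _) (norm_nonneg _)

theorem norm_rightRL_sub_linearCombination_rightA_le (h1 : 1 < α) (h2 : α < 2)
    (hu_cont : Continuous u) (hu : Integrable u) (hu_hat : Integrable (fourierHat u))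
    (hex : RightRLExists (α + 4) u) (hD : Integrable (rightRL (α + 4) u))
    (hD_hat : Integrable (fourierHat (rightRL (α + 4) u))) {c : ℤ →₀ ℂ}
    (hc : ∀ z, Finsupp.linearCombination ℂ (taylorPoly α z) c = 1) :
    ∃ C : ℝ, ∀ h : ℝ, 0 < h → ∀ x : ℝ,
      ‖rightRL α u x - Finsupp.linearCombination ℂ (fun j => rightA α h j u x) c‖ ≤ C * h ^ 4 := by
  have h0 : 0 ≤ α := by linarith
  obtain ⟨C, hC⟩ := norm_sub_weights_shiftSymbol_le h0 hc
  have h6 := integrable_pow_six_mul_kernelDensity h1 h2 hu_cont hu hu_hat hex hD hD_hat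
  have hi := integrable_abs_rpow_mul_fourierHat h2 h6
  have hα := integrable_cpow_mul_fourierHat h0 hu_hat hi
  refine ⟨‖(2 * π : ℂ)⁻¹‖ * (C * ∫ ω : ℝ, |ω| ^ (α + 4) * ‖fourierHat u ω‖), fun h hh x => ?_⟩
  set a : ℂ := ((1 / h ^ α : ℝ) : ℂ) with ha
  have hsi := integrable_shiftSymbol_mul h0 hu_hat a h
  have hLi : Integrable fun ω => Finsupp.linearCombination ℂ
      (fun j => a * shiftSymbol α j (ω * h) * fourierHat u ω) c := by
    simp only [Finsupp.linearCombination_apply, Finsupp.sum, smul_eq_mul]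
    exact integrable_finsetSum _ fun j _ => (hsi j).const_mul _
  have hA : Finsupp.linearCombination ℂ (fun j => rightA α h j u x) c = (2 * π : ℂ)⁻¹ *
      conjFourierHat (fun ω => Finsupp.linearCombination ℂ
        (fun j => a * shiftSymbol α j (ω * h) * fourierHat u ω) c) x := by
    rw [← linearCombination_conjFourierHat c hsi]
    simp only [Finsupp.linearCombination_apply, Finsupp.sum, smul_eq_mul, Finset.mul_sum,
      rightA_eq_conjFourierHat h1 h2 hu_cont hu hu_hat hh]
    exact Finset.sum_congr rfl fun j _ => by ring
  rw [hA, rightRL_eq_conjFourierHat h1 h2 hu_cont hu hu_hat (hex.of_add_four h1 h2) h6,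
    ← mul_sub, norm_mul, mul_assoc]
  refine mul_le_mul_of_nonneg_left ?_ (norm_nonneg _)
  rw [conjFourierHat, conjFourierHat, ← integral_sub (integrable_cexp_mul hα x)
    (integrable_cexp_mul hLi x), mul_right_comm, ← integral_const_mul]
  refine norm_integral_le_of_norm_le (hi.const_mul _) ?_
  filter_upwards [compl_mem_ae_iff.2 (measure_singleton (0 : ℝ))] with ω hω
  have hω0 : ω ≠ 0 := hω
  have hfac : Finsupp.linearCombination ℂ
        (fun j => a * shiftSymbol α j (ω * h) * fourierHat u ω) c =
      a * Finsupp.linearCombination ℂ (fun j => shiftSymbol α j (ω * h)) c * fourierHat u ω := by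
    simp only [Finsupp.linearCombination_apply, Finsupp.sum, smul_eq_mul, Finset.mul_sum,
      Finset.sum_mul]
    exact Finset.sum_congr rfl fun j _ => by ring
  -- Homogeneity puts both multipliers at `θ = ωh` with the factor `h^{-α}`; then `h^{-α} |ωh|^{α+4}
  -- = h⁴ |ω|^{α+4}`.
  have hpow : (I * ω) ^ (α : ℂ) = a * (I * ((ω * h : ℝ) : ℂ)) ^ (α : ℂ) := by
    have hhα : (h : ℂ) ^ (α : ℂ) ≠ 0 := by
      rw [← ofReal_cpow hh.le]
      exact_mod_cast (Real.rpow_pos_of_pos hh α).ne'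
    rw [ofReal_mul, ← mul_assoc, mul_cpow_of_re_nonneg (x := I * ω) (y := h) (by simpa using hω0)
      (by simp) (by simpa using hh), ha]
    push_cast
    rw [ofReal_cpow hh.le]
    field_simp
  rw [hfac, ← mul_sub, ← sub_mul, hpow, ← mul_sub, norm_mul, norm_cexp_neg_I_mul, one_mul,
    norm_mul, norm_mul, ← mul_assoc]
  refine mul_le_mul_of_nonneg_right ?_ (norm_nonneg _)
  have h3 := hC (ω * h) (mul_ne_zero hω0 hh.ne')
  have hpos : 0 < h ^ α := Real.rpow_pos_of_pos hh α
  have hna : ‖a‖ = 1 / h ^ α := by rw [ha, norm_real, Real.norm_of_nonneg (by positivity)]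
  rw [hna]
  refine (mul_le_mul_of_nonneg_left h3 (by positivity)).trans_eq ?_
  rw [abs_mul, abs_of_pos hh, Real.mul_rpow (abs_nonneg _) hh.le, Real.rpow_add hh]
  have h4 : h ^ (4 : ℝ) = h ^ 4 := by norm_cast
  rw [h4]
  field_simp

end

end WSLD

theorem theorem2p6 (α : ℝ) (hα₁ : 1 < α) (hα₂ : α < 2)
    (p q r s p' q' r' s' : ℤ)
    (hpq : p ≠ q) (hrs : r ≠ s) (hpq' : p' ≠ q') (hrs' : r' ≠ s')
    (hpqrs : r * s ≠ p * q) (hpqrs' : r' * s' ≠ p' * q')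
    (hab : WSLD.aCoeff p q r s * WSLD.bCoeff α p' q' r' s' ≠
      WSLD.aCoeff p' q' r' s' * WSLD.bCoeff α p q r s)
    (u : ℝ → ℂ) (hu_cont : Continuous u)
    (hu : MeasureTheory.Integrable u)
    (hu_hat : MeasureTheory.Integrable (WSLD.fourierHat u))
    (hD_exists : WSLD.RightRLExists (α + 4) u)
    (hD : MeasureTheory.Integrable (WSLD.rightRL (α + 4) u))
    (hD_hat : MeasureTheory.Integrable (WSLD.fourierHat (WSLD.rightRL (α + 4) u))) :
    WSLD.RightRLExists α u ∧
    (∀ h : ℝ, 0 < h → ∀ x : ℝ, ∀ j : ℤ,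
      Summable (fun k : ℕ => WSLD.qCoeff α k • u (x + ((k : ℝ) - (j : ℝ)) * h))) ∧
    ∃ C : ℝ, ∀ h : ℝ, 0 < h → ∀ x : ℝ,
      ‖WSLD.rightRL α u x - WSLD.rightA₄ α h p q r s p' q' r' s' u x‖ ≤ C * h ^ 4 := by
  have hex := hD_exists.of_add_four hα₁ hα₂
  refine ⟨hex, fun h _ x j => ?_, ?_⟩
  · exact WSLD.summable_qCoeff_smul hα₁.le hα₂.le
      (WSLD.norm_le_of_fourierHat hu_cont hu hu_hat) _
  · simp only [WSLD.rightA₄_eq]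
    exact WSLD.norm_rightRL_sub_linearCombination_rightA_le hα₁ hα₂ hu_cont hu hu_hat hD_exists hD
      hD_hat (WSLD.weights₄_taylorPoly α hpq hrs hpq' hrs' hpqrs hpqrs' hab)
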